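/- Let $0<a\le b$ and let $K=[0,a]\times[0,b]$. A billiard particle starts at a point of $K$ and moves with unit speed along straight lines, being reflected specularly at the boundary of $K$; its bounce lengths are the distances travelled between consecutive bounces. Let $\mu$ be any probability measure on $K$. Take independent particles $i=1,2,\dots$; the $i$-th one has an initial position with law $\mu$ and, independently of it, an initial direction uniformly distributed on the unit circle. For $M,N\ge 1$, record the first $N$ bounce lengths of each of the first $M$ particles, and let $Y_{M,N}$ be one of these $MN$ lengths (counted with multiplicity), chosen uniformly at random. Then $Y_{M,N}$ converges in distribution to a random variable $Y$ as $M\to\infty$ followed by $N\to\infty$. That is, for each $N$ there is a probability law $\nu_N$ on $\mathbb R$ such that $Y_{M,N}$ converges in distribution to $\nu_N$ as $M\to\infty$, and $\nu_N$ converges weakly to the law of $Y$ as $N\to\infty$. Moreover, almost surely with respect to the sample of the particles, for every $N$ also the uniform distribution on the $MN$ recorded bounce lengths of the given particles converges weakly to $\nu_N$ as $M\to\infty$. Put $r=\sqrt{a^2+b^2}$, $u=\sqrt{t^2-a^2}$ and $w=\sqrt{t^2-b^2}$. The law of $Y$ has the non-negative density $\operatorname{pdf}_Y$ with respect to Lebesgue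 measure, which vanishes outside $(0,r)$ and is given as follows. For $0<t<a$, $$\operatorname{pdf}_Y(t)=\frac2\pi\left(\frac{2(a+b)}{r^2}-\frac{2ab}{r^3}\left(\operatorname{artanh}\frac ar+\operatorname{artanh}\frac br\right)\right);$$ for $a<t<b$, $$\operatorname{pdf}_Y(t)=\frac2\pi\left(\frac{a(b-u)}{t(b+u)u}+\frac{2ab+2at-2au}{t\,r^2}+\frac{2ab}{r^3}\left(-\operatorname{artanh}\frac tr+\operatorname{artanh}\frac{ur}{tb}-\operatorname{artanh}\frac br\right)\right);$$ for $b<t<r$, $$\operatorname{pdf}_Y(t)=\frac2\pi\left(\frac{a(b-u)}{t(b+u)u}+\frac{b(a-w)}{t(a+w)w}+2\,\frac{2ab-au-bw}{t\,r^2}+\frac{2ab}{r^3}\left(-2\operatorname{artanh}\frac tr+\operatorname{artanh}\frac{ur}{tb}+\operatorname{artanh}\frac{wr}{ta}\right)\right).$$ Moreover, for all $t\in(0,r)\setminus\{a,b\}$ one has $\operatorname{pdf}_Y(t)=P_{\mathrm{sing}}(t)+P_{\mathrm{smooth}}(t)$, where $$P_{\mathrm{sing}}(t)=\frac2\pi\left(\mathbf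 1_{t>a}\frac{a(b-u)}{t(b+u)u}+\mathbf 1_{t>b}\frac{b(a-w)}{t(a+w)w}\right),$$ $$P_{\mathrm{smooth}}(t)=\frac2\pi\left(\int_{\max(a,t)}^{r}\frac{2a}{b+\sqrt{T^2-a^2}}\,\frac{dT}{T^2}+\int_{\max(b,t)}^{r}\frac{2b}{a+\sqrt{T^2-b^2}}\,\frac{dT}{T^2}\right).$$ -/

import Mathlib

open MeasureTheory ProbabilityTheory Filter Topology

noncomputable section

/-- The Euclidean plane. -/
abbrev Plane : Type := EuclideanSpace ℝ (Fin 2)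

/-- The closed rectangular box `[0,a] × [0,b]`. -/
def box (a b : ℝ) : Set Plane :=
  {p | p 0 ∈ Set.Icc 0 a ∧ p 1 ∈ Set.Icc 0 b}

/-- The state of a particle is the pair (position, velocity). The time for which a particle in
the given state can move along a straight line before it leaves the box. -/
def flightTime (a b : ℝ) (s : Plane × Plane) : ℝ :=
  sSup {r : ℝ | 0 ≤ r ∧ s.1 + r • s.2 ∈ box a b}

/-- Reflection of one velocity coordinate `w` of a particle whose corresponding position
coordinate is `x ∈ [0,L]`: the sign of `w` is reversed if the particle sits at one of the two walls
`x = 0`, `x = L` and moves towards the outside of it. -/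
def reflectCoord (L x w : ℝ) : ℝ :=
  if (x = 0 ∧ w < 0) ∨ (x = L ∧ 0 < w) then -w else w

/-- Fly along a straight line until the boundary stops the particle, then reflect specularly.
The new state is the state immediately after the bounce. -/
def bounceMap (a b : ℝ) (s : Plane × Plane) : Plane × Plane :=
  let q : Plane := s.1 + flightTime a b s • s.2
  (q, !₂[reflectCoord a (q 0) (s.2 0), reflectCoord b (q 1) (s.2 1)])

/-- The position of the particle with initial state `s` at its `k`-th bounce (`k = 1, 2, …`). -/
def bouncePoint (a b : ℝ) (s : Plane × Plane) (k : ℕ) : Plane :=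
  ((bounceMap a b)^[k] s).1

/-- The `k`-th bounce length (`k = 0, 1, …`) of the particle with initial state `s`: the distance
travelled between the `(k+1)`-st and the `(k+2)`-nd bounce. The way from the initial position to
the first bounce is not a bounce length. -/
def bounceLength (a b : ℝ) (s : Plane × Plane) (k : ℕ) : ℝ :=
  dist (bouncePoint a b s (k + 1)) (bouncePoint a b s (k + 2))

/-- The uniform probability measure on the unit circle: the law of `(cos φ, sin φ)` for an angle
`φ` that is uniformly distributed on `(0, 2π]`. -/
def uniformDirection : Measure Plane :=
  (ENNReal.ofReal (2 * Real.pi))⁻¹ •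
    (volume.restrict (Set.Ioc 0 (2 * Real.pi))).map
      (fun φ : ℝ => (!₂[Real.cos φ, Real.sin φ] : Plane))

/-- The uniform probability measure on `{0,…,M-1} × {0,…,N-1}`, which is used to select one of the
`M * N` bounce lengths obtained from `M` particles with `N` bounce lengths each. -/
def uniformSelection (M N : ℕ+) : Measure (Fin M × Fin N) :=
  (PMF.uniformOfFintype (Fin M × Fin N)).toMeasure

instance (M N : ℕ+) : IsProbabilityMeasure (uniformSelection M N) := by
  unfold uniformSelection; infer_instance

/-- The density of the absorption model for the box with side lengths `a ≤ b`. -/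
def absorptionPDF (a b t : ℝ) : ℝ :=
  if 0 < t ∧ t < a then
    2 / Real.pi *
      (2 * (a + b) / (a ^ 2 + b ^ 2)
        - 2 * a * b / (a ^ 2 + b ^ 2) ^ (3 / 2 : ℝ)
          * (Real.artanh (a / √(a ^ 2 + b ^ 2)) + Real.artanh (b / √(a ^ 2 + b ^ 2))))
  else if a < t ∧ t < b then
    2 / Real.pi *
      (a * (b - √(t ^ 2 - a ^ 2)) / (t * (b + √(t ^ 2 - a ^ 2)) * √(t ^ 2 - a ^ 2))
        + (2 * a * b + 2 * a * t - 2 * a * √(t ^ 2 - a ^ 2)) / (t * (a ^ 2 + b ^ 2))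
        + 2 * a * b
          * (-Real.artanh (t / √(a ^ 2 + b ^ 2))
            + Real.artanh (√(t ^ 2 - a ^ 2) * √(a ^ 2 + b ^ 2) / (t * b))
            - Real.artanh (b / √(a ^ 2 + b ^ 2)))
          / (a ^ 2 + b ^ 2) ^ (3 / 2 : ℝ))
  else if b < t ∧ t < √(a ^ 2 + b ^ 2) then
    2 / Real.pi *
      (a * (b - √(t ^ 2 - a ^ 2)) / (t * (b + √(t ^ 2 - a ^ 2)) * √(t ^ 2 - a ^ 2))
        + b * (a - √(t ^ 2 - b ^ 2)) / (t * (a + √(t ^ 2 - b ^ 2)) * √(t ^ 2 - b ^ 2))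
        + 2 * ((2 * a * b - a * √(t ^ 2 - a ^ 2) - b * √(t ^ 2 - b ^ 2)) / (t * (a ^ 2 + b ^ 2)))
        + 2 * a * b
          * (-2 * Real.artanh (t / √(a ^ 2 + b ^ 2))
            + Real.artanh (√(t ^ 2 - a ^ 2) * √(a ^ 2 + b ^ 2) / (t * b))
            + Real.artanh (√(t ^ 2 - b ^ 2) * √(a ^ 2 + b ^ 2) / (t * a)))
          / (a ^ 2 + b ^ 2) ^ (3 / 2 : ℝ))
  else 0

/-- The singular part of the density. -/
def singularPart (a b t : ℝ) : ℝ :=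
  2 / Real.pi *
    ((if a < t then
        a * (b - √(t ^ 2 - a ^ 2)) / (t * (b + √(t ^ 2 - a ^ 2)) * √(t ^ 2 - a ^ 2)) else 0)
      + (if b < t then
        b * (a - √(t ^ 2 - b ^ 2)) / (t * (a + √(t ^ 2 - b ^ 2)) * √(t ^ 2 - b ^ 2)) else 0))

/-- The smooth part of the density. -/
def smoothPart (a b t : ℝ) : ℝ :=
  2 / Real.pi *
    ((∫ T in (max a t)..(√(a ^ 2 + b ^ 2)), 2 * a / (b + √(T ^ 2 - a ^ 2)) * (1 / T ^ 2))
      + ∫ T in (max b t)..(√(a ^ 2 + b ^ 2)), 2 * b / (a + √(T ^ 2 - b ^ 2)) * (1 / T ^ 2))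

end

/-! ### Equidistribution of the orbits of an irrational rotation -/

/-! Unless its direction is parallel to a wall, a particle moves independently in the two
coordinates, bouncing in each between one pair of walls. It thus carries two clocks that show the
times to the next wall of either kind and have the periods α = a/|v₀| and β = b/|v₁|. At unit speed
a bounce length is the smaller of the two readings just after a bounce (`wallClocks_clockBounceMap`,
`bounceLength_eq_min`).

Let α ≤ β. A ring of the slow clock cuts a period of the fast clock into pieces d and α − d; the
uncut periods are bounce lengths α (`clock_sum`). If α and β are incommensurable, then d is
equidistributed on [0, α] by Weyl's theorem, and the averages of f along the orbit tend to (2 ∫₀^α f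
+ (β − α) f(α)) / (α + β) (`tendsto_clock_average`). Almost every direction qualifies and the limit
does not depend on the starting point. By dominated convergence the limit N → ∞ is the mean of this
expression over the directions, whatever μ is (`tendsto_integral_bounceLength`).

To evaluate this mean, the directions in the first quadrant below the diagonal are parametrized by T
= a / cos φ, which is then the shorter period. The term with f(α) yields the singular part. The term
with the integral yields, after an exchange of integrations, the smooth part. The directions above
the diagonal contribute the same with a and b interchanged (`integral_clockMean_uniformDirection`).
An explicit primitive turns the integrals into the closed form (`absorptionPDF_eq_add`).

For fixed N the law of Y_{M,N} is the same for all M (`integral_sampledLength`). The almost sure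
statement is the strong law of large numbers, applied to countably many intervals
(`ae_tendsto_frequency`). -/

lemma norm_inv_mul_sum_le {n : ℕ} {u : ℕ → ℂ} {C : ℝ} (hC : 0 ≤ C) (hu : ∀ k, ‖u k‖ ≤ C) :
    ‖(n : ℂ)⁻¹ * ∑ k ∈ Finset.range n, u k‖ ≤ C := by
  rcases Nat.eq_zero_or_pos n with rfl | hn
  · simpa using hC
  have hn' : (0 : ℝ) < n := by exact_mod_cast hn
  have h : ‖∑ k ∈ Finset.range n, u k‖ ≤ n * C := by
    simpa using norm_sum_le_of_le (Finset.range n) (fun k _ => hu k)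
  rw [norm_mul, norm_inv, Complex.norm_natCast, inv_mul_le_iff₀ hn']
  exact h

lemma tendsto_average_fourier {T : ℝ} [hT : Fact (0 < T)] {β : ℝ}
    (hβ : ∀ n : ℤ, n ≠ 0 → ∀ m : ℤ, n * β ≠ m * T) {m : ℤ} (hm : m ≠ 0) (x : AddCircle T) :
    Tendsto (fun n : ℕ => (n : ℂ)⁻¹ * ∑ k ∈ Finset.range n,
      fourier m (x + k • (β : AddCircle T))) atTop (𝓝 0) := by
  set z : ℂ := fourier m (β : AddCircle T) with hz
  have hzn : ‖z‖ = 1 := by rw [hz, fourier_apply]; exact Circle.norm_coe _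
  have hxn : ‖fourier m x‖ = 1 := by rw [fourier_apply]; exact Circle.norm_coe _
  -- If z were 1, then m β would be an integer multiple of T. As z ≠ 1, the sums over the orbit are
  -- geometric and bounded by 2 / ‖z - 1‖ for all n.
  have hz1 : z ≠ 1 := by
    intro h
    rw [hz, fourier_coe_apply, Complex.exp_eq_one_iff] at h
    obtain ⟨n, hn⟩ := h
    have hT0 : (T : ℂ) ≠ 0 := by exact_mod_cast hT.out.ne'
    have h2 : (2 * Real.pi * Complex.I : ℂ) ≠ 0 := Complex.two_pi_I_ne_zero
    have h3 : (2 * Real.pi * Complex.I : ℂ) * (m * β) = (2 * Real.pi * Complex.I) * (n * T) := by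
      field_simp at hn
      linear_combination (2 * Real.pi * Complex.I) * hn
    have h4 := mul_left_cancel₀ h2 h3
    exact hβ m hm n (by exact_mod_cast h4)
  have hpow : ∀ k : ℕ, fourier m (x + k • (β : AddCircle T)) = fourier m x * z ^ k := by
    intro k
    simp only [hz, fourier_apply, smul_add, AddCircle.toCircle_add, Circle.coe_mul]
    rw [smul_comm, AddCircle.toCircle_nsmul, Circle.coe_pow]
  have hb : ∀ n : ℕ, ‖∑ k ∈ Finset.range n, fourier m (x + k • (β : AddCircle T))‖
      ≤ 2 / ‖z - 1‖ := by
    intro n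
    simp only [hpow, ← Finset.mul_sum]
    rw [geom_sum_eq hz1, norm_mul, hxn, one_mul, norm_div]
    gcongr
    calc ‖z ^ n - 1‖ ≤ ‖z ^ n‖ + ‖(1 : ℂ)‖ := norm_sub_le _ _
      _ = 2 := by rw [norm_pow, hzn]; norm_num
  have h0 : Tendsto (fun n : ℕ => (n : ℂ)⁻¹) atTop (𝓝 0) := tendsto_inv_atTop_nhds_zero_nat
  refine h0.zero_mul_isBoundedUnder_le ?_
  exact isBoundedUnder_of ⟨2 / ‖z - 1‖, hb⟩

/-- True for characters, hence for trigonometric polynomials, which are uniformly dense. Averages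
and integral are both 1-Lipschitz in the supremum norm, so an ε/3 argument concludes. -/
theorem tendsto_average_rotation {T : ℝ} [hT : Fact (0 < T)] {β : ℝ}
    (hβ : ∀ n : ℤ, n ≠ 0 → ∀ m : ℤ, n * β ≠ m * T) (G : C(AddCircle T, ℂ)) (x : AddCircle T) :
    Tendsto (fun n : ℕ => (n : ℂ)⁻¹ * ∑ k ∈ Finset.range n, G (x + k • (β : AddCircle T)))
      atTop (𝓝 (∫ t, G t ∂AddCircle.haarAddCircle)) := by
  have hint : ∀ F : C(AddCircle T, ℂ), Integrable F AddCircle.haarAddCircle := fun F =>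
    F.continuous.integrable_of_hasCompactSupport (HasCompactSupport.of_compactSpace F)
  have hspan : ∀ F ∈ Submodule.span ℂ (Set.range (@fourier T)),
      Tendsto (fun n : ℕ => (n : ℂ)⁻¹ * ∑ k ∈ Finset.range n, F (x + k • (β : AddCircle T)))
        atTop (𝓝 (∫ t, F t ∂AddCircle.haarAddCircle)) := by
    intro F hF
    induction hF using Submodule.span_induction with
    | mem F hF =>
      obtain ⟨m, rfl⟩ := hF
      rcases eq_or_ne m 0 with rfl | hm
      · simp only [fourier_zero, Finset.sum_const, Finset.card_range, nsmul_eq_mul, mul_one,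
          integral_const, probReal_univ, one_smul]
        refine tendsto_const_nhds.congr' ?_
        filter_upwards [eventually_gt_atTop 0] with n hn
        exact (inv_mul_cancel₀ (by exact_mod_cast hn.ne')).symm
      · have h := congrFun (fourierCoeff_fourier (T := T) m) 0
        simp only [fourierCoeff, neg_zero, fourier_zero, one_smul] at h
        rw [Pi.single_eq_of_ne hm.symm] at h
        rw [h]
        exact tendsto_average_fourier hβ hm x
    | zero => simp
    | add F H _ _ hF hH =>
      simp only [ContinuousMap.add_apply, Finset.sum_add_distrib, mul_add]
      rw [integral_add (hint F) (hint H)]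
      exact hF.add hH
    | smul c F _ hF =>
      simp only [ContinuousMap.smul_apply, smul_eq_mul, ← Finset.mul_sum]
      rw [integral_const_mul]
      simpa only [mul_left_comm] using hF.const_mul c
  have hG : G ∈ (Submodule.span ℂ (Set.range (@fourier T))).topologicalClosure := by
    rw [span_fourier_closure_eq_top]; trivial
  rw [← SetLike.mem_coe, Submodule.topologicalClosure_coe] at hG
  rw [Metric.tendsto_atTop]
  intro ε hε
  obtain ⟨F, hF, hFG⟩ := Metric.mem_closure_iff.1 hG (ε / 3) (by positivity)
  obtain ⟨N, hN⟩ := Metric.tendsto_atTop.1 (hspan F hF) (ε / 3) (by positivity)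
  refine ⟨N, fun n hn => ?_⟩
  have hpt : ∀ y, ‖G y - F y‖ ≤ dist G F := fun y => by
    rw [← dist_eq_norm]; exact ContinuousMap.dist_apply_le_dist y
  have h1 : ‖(n : ℂ)⁻¹ * ∑ k ∈ Finset.range n, G (x + k • (β : AddCircle T)) -
      (n : ℂ)⁻¹ * ∑ k ∈ Finset.range n, F (x + k • (β : AddCircle T))‖ ≤ dist G F := by
    rw [← mul_sub, ← Finset.sum_sub_distrib]
    exact norm_inv_mul_sum_le dist_nonneg (fun k => hpt _)
  have h2 : ‖∫ t, F t ∂AddCircle.haarAddCircle - ∫ t, G t ∂AddCircle.haarAddCircle‖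
      ≤ dist G F := by
    rw [← integral_sub (hint F) (hint G)]
    have := norm_integral_le_of_norm_le_const (μ := @AddCircle.haarAddCircle T _)
      (f := fun t => F t - G t) (C := dist G F)
      (Eventually.of_forall fun t => by rw [norm_sub_rev]; exact hpt t)
    simpa using this
  have h3 := hN n hn
  rw [dist_eq_norm] at h3 ⊢
  calc _ = ‖_ + _ + _‖ := by congr 1; ring
    _ ≤ dist G F + ε / 3 + dist G F := (norm_add₃_le).trans (add_le_add (add_le_add h1 h3.le) h2)
    _ < ε := by linarith

/-- Weyl's theorem for a real function that is continuous on a period and agrees at its ends. -/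
theorem tendsto_average_of_mod {T : ℝ} (hT : 0 < T) {β : ℝ}
    (hβ : ∀ n : ℤ, n ≠ 0 → ∀ m : ℤ, n * β ≠ m * T) {g : ℝ → ℝ} (hg : Continuous g)
    (hgT : g 0 = g T) (x : ℝ) {d : ℕ → ℝ} (hd : ∀ k, d k ∈ Set.Ico 0 T)
    (hdx : ∀ k, ∃ m : ℤ, d k = x + k * β + m * T) :
    Tendsto (fun n : ℕ => (n : ℝ)⁻¹ * ∑ k ∈ Finset.range n, g (d k))
      atTop (𝓝 (T⁻¹ * ∫ t in 0..T, g t)) := by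
  have : Fact (0 < T) := ⟨hT⟩
  have hc : Continuous (AddCircle.liftIco T 0 (fun t => (g t : ℂ))) :=
    AddCircle.liftIco_zero_continuous (by rw [hgT]) (by fun_prop)
  have h := tendsto_average_rotation hβ ⟨_, hc⟩ (x : AddCircle T)
  have hval : ∀ k : ℕ, AddCircle.liftIco T 0 (fun t => (g t : ℂ))
      ((x : AddCircle T) + k • (β : AddCircle T)) = g (d k) := by
    intro k
    obtain ⟨m, hm⟩ := hdx k
    have : (x : AddCircle T) + k • (β : AddCircle T) = (d k : AddCircle T) := by
      rw [hm, AddCircle.coe_add, AddCircle.coe_add]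
      have h1 : ((m * T : ℝ) : AddCircle T) = 0 := by
        rw [AddCircle.coe_eq_zero_iff]; exact ⟨m, by simp⟩
      rw [h1, add_zero, ← nsmul_eq_mul, AddCircle.coe_nsmul]
    rw [this, AddCircle.liftIco_zero_coe_apply (hd k)]
  simp only [ContinuousMap.coe_mk, hval] at h
  rw [AddCircle.integral_haarAddCircle, ← AddCircle.intervalIntegral_preimage T 0, zero_add] at h
  have hI : ∫ t in (0 : ℝ)..T, AddCircle.liftIco T 0 (fun t => (g t : ℂ)) (t : AddCircle T)
      = ((∫ t in (0 : ℝ)..T, g t : ℝ) : ℂ) := by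
    rw [← intervalIntegral.integral_ofReal]
    -- The lift takes its values from `[0, T)`, and the remaining end `T` is a null set.
    refine intervalIntegral.integral_congr_ae ?_
    have : ∀ᵐ t : ℝ, t ≠ T := by simp [ae_iff]
    filter_upwards [this] with t ht hmem
    rw [Set.uIoc_of_le hT.le] at hmem
    exact AddCircle.liftIco_zero_coe_apply ⟨hmem.1.le, lt_of_le_of_ne hmem.2 ht⟩
  rw [hI] at h
  have h' := (Complex.continuous_re.tendsto _).comp h
  convert h' using 2
  · simp only [Function.comp]
    rw [← Complex.ofReal_natCast, ← Complex.ofReal_inv, ← Complex.ofReal_sum, ← Complex.ofReal_mul,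
      Complex.ofReal_re]
  · rw [Complex.real_smul, ← Complex.ofReal_mul, Complex.ofReal_re]

/-! ### Two clocks

A particle in a box carries two clocks that show the times until it reaches the next wall of either
direction. They run down simultaneously and are reset to the periods `α` and `β`. -/

noncomputable section

/-- The state of the two clocks just after the next time at which at least one of them rings. -/
def clockStep (α β : ℝ) (p : ℝ × ℝ) : ℝ × ℝ :=
  (if p.1 ≤ p.2 then α else p.1 - p.2, if p.2 ≤ p.1 then β else p.2 - p.1)

/-- The limit of the averages of `f` over the times between consecutive rings. -/
def clockMean (α β : ℝ) (f : ℝ → ℝ) : ℝ :=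
  (2 * (∫ t in 0..(min α β), f t) + |β - α| * f (min α β)) / (α + β)

end

lemma clockMean_swap (α β : ℝ) (f : ℝ → ℝ) : clockMean β α f = clockMean α β f := by
  simp only [clockMean, min_comm β α, abs_sub_comm α β, add_comm β α]

lemma clockStep_swap (α β : ℝ) (p : ℝ × ℝ) :
    clockStep β α p.swap = (clockStep α β p).swap := rfl

lemma clockStep_mem {α β : ℝ} (hα : 0 < α) (hβ : 0 < β) {p : ℝ × ℝ}
    (h1 : p.1 ∈ Set.Icc 0 α) (h2 : p.2 ∈ Set.Icc 0 β) :
    (clockStep α β p).1 ∈ Set.Ioc 0 α ∧ (clockStep α β p).2 ∈ Set.Ioc 0 β := by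
  obtain ⟨h1, h1'⟩ := h1
  obtain ⟨h2, h2'⟩ := h2
  simp only [clockStep, Set.mem_Ioc]
  split_ifs <;> refine ⟨⟨?_, ?_⟩, ?_, ?_⟩ <;> linarith

/-- Either the fast clock has just been reset, or only the slow one has, which then shows β ≥ α.
Consequently, when the slow clock rings strictly first, the fast one shows a full period. -/
lemma clockStep_eq_or_le {α β : ℝ} (hαβ : α ≤ β) {p : ℝ × ℝ}
    (h1 : p.1 ∈ Set.Icc 0 α) (h2 : p.2 ∈ Set.Icc 0 β) :
    (clockStep α β p).1 = α ∨ (clockStep α β p).1 ≤ (clockStep α β p).2 := by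
  obtain ⟨h1, h1'⟩ := h1
  obtain ⟨h2, h2'⟩ := h2
  simp only [clockStep]
  split_ifs
  · left; rfl
  · left; rfl
  · right; linarith
  · right; linarith

/-! ### Counting the rings of the two clocks -/

section counting

variable {α β : ℝ} {p : ℕ → ℝ × ℝ}

lemma clock_bounds (hα : 0 < α) (hαβ : α ≤ β) (hp : ∀ k, p (k + 1) = clockStep α β (p k))
    (h1 : (p 0).1 ∈ Set.Ioc 0 α) (h2 : (p 0).2 ∈ Set.Ioc 0 β)
    (h3 : (p 0).1 = α ∨ (p 0).1 ≤ (p 0).2) (k : ℕ) :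
    (p k).1 ∈ Set.Ioc 0 α ∧ (p k).2 ∈ Set.Ioc 0 β ∧ ((p k).1 = α ∨ (p k).1 ≤ (p k).2) := by
  induction k with
  | zero => exact ⟨h1, h2, h3⟩
  | succ k ih =>
    have i1 := Set.Ioc_subset_Icc_self ih.1
    have i2 := Set.Ioc_subset_Icc_self ih.2.1
    rw [hp]
    have := clockStep_mem hα (hα.trans_le hαβ) i1 i2
    exact ⟨this.1, this.2, clockStep_eq_or_le hαβ i1 i2⟩

open Classical in
-- Both readings run down by the same amount, so their difference changes only at resets.
lemma clock_sub (hp : ∀ k, p (k + 1) = clockStep α β (p k)) (k : ℕ) :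
    (p k).1 - (p k).2 = (p 0).1 - (p 0).2
      + Nat.count (fun i => (p i).1 ≤ (p i).2) k * α
      - Nat.count (fun i => (p i).2 ≤ (p i).1) k * β := by
  induction k with
  | zero => simp
  | succ k ih =>
    rw [hp, Nat.count_succ, Nat.count_succ]
    simp only [clockStep]
    rcases lt_trichotomy (p k).1 (p k).2 with h | h | h
    · rw [if_pos h.le, if_neg h.not_ge, if_pos h.le, if_neg h.not_ge]; push_cast; linarith
    · rw [if_pos h.le, if_pos h.ge, if_pos h.le, if_pos h.ge]; push_cast; linarith
    · rw [if_neg h.not_ge, if_pos h.le, if_neg h.not_ge, if_pos h.le]; push_cast; linarith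

open Classical in
-- Every step ends with a ring of at least one clock; simultaneous rings are counted twice.
lemma clock_count_add (k : ℕ) :
    Nat.count (fun i => (p i).1 ≤ (p i).2) k + Nat.count (fun i => (p i).2 ≤ (p i).1) k
      = k + Nat.count (fun i => (p i).1 = (p i).2) k := by
  induction k with
  | zero => simp
  | succ k ih =>
    rw [Nat.count_succ, Nat.count_succ, Nat.count_succ]
    rcases lt_trichotomy (p k).1 (p k).2 with h | h | h
    · rw [if_pos h.le, if_neg h.not_ge, if_neg h.ne]; omega
    · rw [if_pos h.le, if_pos h.ge, if_pos h]; omega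
    · rw [if_neg h.not_ge, if_pos h.le, if_neg h.ne']; omega

open Classical in
-- By `clock_sub`, two simultaneous rings would make a positive multiple of β a multiple of α.
lemma clock_count_eq_le_one (hirr : ∀ n : ℤ, n ≠ 0 → ∀ m : ℤ, n * β ≠ m * α)
    (hp : ∀ k, p (k + 1) = clockStep α β (p k)) (k : ℕ) :
    Nat.count (fun i => (p i).1 = (p i).2) k ≤ 1 := by
  have huniq : ∀ i j, i < j → (p i).1 = (p i).2 → (p j).1 ≠ (p j).2 := by
    intro i j hij hi hj
    have e1 := clock_sub hp i
    have e2 := clock_sub hp j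
    rw [hi, sub_self] at e1
    rw [hj, sub_self] at e2
    have hlt : Nat.count (fun i => (p i).2 ≤ (p i).1) i
        < Nat.count (fun i => (p i).2 ≤ (p i).1) j :=
      Nat.count_strict_mono hi.ge hij
    refine hirr (Nat.count (fun i => (p i).2 ≤ (p i).1) j
      - Nat.count (fun i => (p i).2 ≤ (p i).1) i : ℤ) (by omega)
      (Nat.count (fun i => (p i).1 ≤ (p i).2) j
      - Nat.count (fun i => (p i).1 ≤ (p i).2) i : ℤ) ?_
    push_cast
    linarith
  rw [Nat.count_eq_card_filter_range, Finset.card_le_one]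
  intro i hi j hj
  simp only [Finset.mem_filter] at hi hj
  rcases lt_trichotomy i j with h | h | h
  · exact absurd hj.2 (huniq i j h hi.2)
  · exact h
  · exact absurd hi.2 (huniq j i h hj.2)

open Classical in
/-- The sum over the times between rings, sorted by the rings of the slow clock. -/
lemma clock_sum (hα : 0 < α) (hαβ : α ≤ β) (hp : ∀ k, p (k + 1) = clockStep α β (p k))
    (h1 : (p 0).1 ∈ Set.Ioc 0 α) (h2 : (p 0).2 ∈ Set.Ioc 0 β)
    (h3 : (p 0).1 = α ∨ (p 0).1 ≤ (p 0).2) (f : ℝ → ℝ) {d : ℕ → ℝ}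
    (hd : ∀ n, d n = α * Int.fract (((p 0).1 - (p 0).2 - n * β) / α)) (k : ℕ) :
    ∑ i ∈ Finset.range k, f (min (p i).1 (p i).2)
      = ∑ n ∈ Finset.range (Nat.count (fun i => (p i).2 ≤ (p i).1) k), (f (d n) + f (α - d n))
        + ((Nat.count (fun i => (p i).1 ≤ (p i).2) k : ℝ)
            - Nat.count (fun i => (p i).2 ≤ (p i).1) k) * f α
        - f (p k).1 + f (p 0).1 - Nat.count (fun i => (p i).1 = (p i).2) k * f 0 := by
  induction k with
  | zero => simp
  | succ k ih =>
    obtain ⟨b1, b2, b3⟩ := clock_bounds hα hαβ hp h1 h2 h3 k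
    -- When the slow clock rings, `d` is what the fast clock still has to run. It lies in `[0, α)`,
    -- so it is the representative that the fractional part selects.
    have hdk : (p k).2 ≤ (p k).1 → d (Nat.count (fun i => (p i).2 ≤ (p i).1) k)
        = (p k).1 - (p k).2 := by
      intro hle
      have e : ((p 0).1 - (p 0).2
          - (Nat.count (fun i => (p i).2 ≤ (p i).1) k : ℕ) * β) / α
          = ((p k).1 - (p k).2) / α
            - (Nat.count (fun i => (p i).1 ≤ (p i).2) k : ℕ) := by
        rw [clock_sub hp k]; field_simp; ring
      rw [hd, e, Int.fract_sub_natCast, Int.fract_eq_self.2, mul_div_cancel₀ _ hα.ne']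
      refine ⟨div_nonneg (by linarith) hα.le, ?_⟩
      rw [div_lt_one hα]
      linarith [b1.2, b2.1]
    rw [Finset.sum_range_succ, ih, hp, Nat.count_succ, Nat.count_succ, Nat.count_succ]
    simp only [clockStep]
    -- The fast period under way is booked in full by the term `- f (p k).1`, which telescopes when
    -- the fast clock rings. A slow ring trades it for two pieces. At a simultaneous ring one piece
    -- is empty; its spurious `f 0` is subtracted.
    rcases lt_trichotomy (p k).1 (p k).2 with h | h | h
    · rw [if_pos h.le, if_pos h.le, if_neg h.not_ge, if_neg h.ne, min_eq_left h.le, add_zero,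
        add_zero]
      push_cast; ring
    · rw [if_pos h.le, if_pos h.le, if_pos h.ge, if_pos h, min_eq_left h.le,
        Finset.sum_range_succ, hdk h.ge, h, sub_self, sub_zero]
      push_cast; ring
    · have hx : (p k).1 = α := b3.resolve_right h.not_ge
      rw [if_neg h.not_ge, if_neg h.not_ge, if_pos h.le, if_neg h.ne', min_eq_right h.le,
        Finset.sum_range_succ, hdk h.le, hx, add_zero, add_zero, sub_sub_cancel]
      push_cast; ring

end counting

lemma tendsto_inv_mul_of_bounded {u : ℕ → ℝ} {C : ℝ} (hu : ∀ k, |u k| ≤ C) :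
    Tendsto (fun k : ℕ => (k : ℝ)⁻¹ * u k) atTop (𝓝 0) :=
  tendsto_inv_atTop_nhds_zero_nat.zero_mul_isBoundedUnder_le (isBoundedUnder_of ⟨C, hu⟩)

lemma tendsto_clock_average_of_le {α β : ℝ} {p : ℕ → ℝ × ℝ} (hα : 0 < α) (hαβ : α ≤ β)
    (hirr : ∀ n : ℤ, n ≠ 0 → ∀ m : ℤ, n * β ≠ m * α)
    (hp : ∀ k, p (k + 1) = clockStep α β (p k))
    (h1 : (p 0).1 ∈ Set.Ioc 0 α) (h2 : (p 0).2 ∈ Set.Ioc 0 β)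
    (h3 : (p 0).1 = α ∨ (p 0).1 ≤ (p 0).2) {f : ℝ → ℝ} (hf : Continuous f) {C : ℝ}
    (hC : ∀ t, |f t| ≤ C) :
    Tendsto (fun n : ℕ => (n : ℝ)⁻¹ * ∑ k ∈ Finset.range n, f (min (p k).1 (p k).2))
      atTop (𝓝 (clockMean α β f)) := by
  classical
  have hβ : 0 < β := hα.trans_le hαβ
  set nA : ℕ → ℕ := fun k => Nat.count (fun i => (p i).1 ≤ (p i).2) k with hnA
  set nB : ℕ → ℕ := fun k => Nat.count (fun i => (p i).2 ≤ (p i).1) k with hnB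
  set E : ℕ → ℕ := fun k => Nat.count (fun i => (p i).1 = (p i).2) k with hE
  set d : ℕ → ℝ := fun n => α * Int.fract (((p 0).1 - (p 0).2 - n * β) / α) with hd
  have hE1 : ∀ k, (E k : ℝ) ≤ 1 := fun k => by
    exact_mod_cast clock_count_eq_le_one hirr hp k
  have hE0 : ∀ k, (0 : ℝ) ≤ E k := fun k => Nat.cast_nonneg _
  have hsum : ∀ k, (nA k : ℝ) + nB k = k + E k := fun k => by
    exact_mod_cast clock_count_add k
  have hsub := fun k => clock_sub hp k
  have hb := fun k => clock_bounds hα hαβ hp h1 h2 h3 k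
  have hαβ0 : 0 < α + β := by linarith
  -- Eliminating the fast rings from `clock_sub` and `clock_count_add` gives (α + β) nB = k α + (E α
  -- + a difference of readings), where the bracket is bounded.
  have hlimB : Tendsto (fun k : ℕ => (k : ℝ)⁻¹ * nB k) atTop (𝓝 (α / (α + β))) := by
    have hbd := tendsto_inv_mul_of_bounded (u := fun k => (nB k : ℝ) - k * (α / (α + β)))
      (C := (α + (α + β + α + β)) / (α + β)) (fun k => by
        have e : (nB k : ℝ) - k * (α / (α + β))
            = (E k * α + ((p 0).1 - (p 0).2 - ((p k).1 - (p k).2))) / (α + β) := by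
          have e1 := hsub k
          have e2 := hsum k
          rw [eq_div_iff hαβ0.ne']
          field_simp
          change (p k).1 - (p k).2 = (p 0).1 - (p 0).2 + nA k * α - nB k * β at e1
          linear_combination α * e2 + e1
        rw [e, abs_div, abs_of_pos hαβ0]
        gcongr
        have b := hb k
        obtain ⟨⟨b1, b2⟩, ⟨b3, b4⟩, -⟩ := hb k
        obtain ⟨c1, c2⟩ := h1
        obtain ⟨c3, c4⟩ := h2
        have i1 : E k * α ≤ 1 * α := by gcongr; exact hE1 k
        have i2 : 0 ≤ E k * α := mul_nonneg (hE0 k) hα.le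
        rw [abs_le]
        constructor <;> linarith)
    have := hbd.add_const (α / (α + β))
    rw [zero_add] at this
    refine this.congr' ?_
    filter_upwards [eventually_gt_atTop 0] with k hk
    have : (k : ℝ) ≠ 0 := by exact_mod_cast hk.ne'
    field_simp
    ring
  have hlimA : Tendsto (fun k : ℕ => (k : ℝ)⁻¹ * ((nA k : ℝ) - nB k)) atTop
      (𝓝 ((β - α) / (α + β))) := by
    have hbd := tendsto_inv_mul_of_bounded (u := fun k => (E k : ℝ)) (C := 1) (fun k => by
      rw [abs_of_nonneg (hE0 k)]; exact hE1 k)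
    have := ((hlimB.const_mul (-2)).add_const 1).add hbd
    have e : (β - α) / (α + β) = -2 * (α / (α + β)) + 1 + 0 := by field_simp; ring
    rw [e]
    refine this.congr' ?_
    filter_upwards [eventually_gt_atTop 0] with k hk
    have : (k : ℝ) ≠ 0 := by exact_mod_cast hk.ne'
    field_simp
    linarith [hsum k]
  -- Weyl's theorem runs over the slow rings, so their number has to tend to infinity.
  have hBtop : Tendsto nB atTop atTop := by
    rw [← tendsto_natCast_atTop_iff (R := ℝ)]
    have := hlimB.pos_mul_atTop (by positivity) (tendsto_natCast_atTop_atTop (R := ℝ))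
    refine this.congr' ?_
    filter_upwards [eventually_gt_atTop 0] with k hk
    have : (k : ℝ) ≠ 0 := by exact_mod_cast hk.ne'
    field_simp
  -- From one slow ring to the next, `d` is rotated by -β on a circle of length α. The symmetrized
  -- function t ↦ f t + f (α - t) agrees at the ends 0 and α without any periodicity of f.
  have hweyl := tendsto_average_of_mod hα (β := -β)
    (fun n hn m h => hirr n hn (-m) (by push_cast; linarith))
    (g := fun t => f t + f (α - t)) (by fun_prop) (by simp [add_comm])
    ((p 0).1 - (p 0).2) (d := d)
    (fun k => ⟨mul_nonneg hα.le (Int.fract_nonneg _), by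
      have := mul_lt_mul_of_pos_left (Int.fract_lt_one
        (((p 0).1 - (p 0).2 - k * β) / α)) hα
      simpa [hd] using this⟩)
    (fun k => ⟨-⌊((p 0).1 - (p 0).2 - k * β) / α⌋, by
      simp only [hd, Int.fract, Int.cast_neg]; field_simp; ring⟩)
  have hweyl' := hweyl.comp hBtop
  have hrest := tendsto_inv_mul_of_bounded
    (u := fun k => - f (p k).1 + f (p 0).1 - E k * f 0) (C := C + C + C) (fun k => by
      have t1 := hC (p k).1
      have t2 := hC (p 0).1
      have t3 : |(E k : ℝ) * f 0| ≤ C := by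
        rw [abs_mul, abs_of_nonneg (hE0 k)]
        calc (E k : ℝ) * |f 0| ≤ 1 * |f 0| := by gcongr; exact hE1 k
          _ ≤ C := by rw [one_mul]; exact hC 0
      rw [abs_le] at *
      constructor <;> linarith)
  have hall := ((hlimB.mul hweyl').add (hlimA.mul_const (f α))).add hrest
  have hval : clockMean α β f = α / (α + β) * (α⁻¹ * ∫ t in 0..α, (f t + f (α - t)))
      + (β - α) / (α + β) * f α + 0 := by
    rw [clockMean, min_eq_left hαβ, abs_of_nonneg (sub_nonneg.2 hαβ),
      intervalIntegral.integral_add (hf.intervalIntegrable _ _)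
        ((by fun_prop : Continuous fun t => f (α - t)).intervalIntegrable _ _),
      intervalIntegral.integral_comp_sub_left (fun t => f t), sub_self, sub_zero]
    field_simp
    ring
  rw [hval]
  refine hall.congr' ?_
  filter_upwards [eventually_gt_atTop 0, hBtop.eventually_gt_atTop 0] with k hk hk'
  have hk0 : (k : ℝ) ≠ 0 := by exact_mod_cast hk.ne'
  have hB0 : (nB k : ℝ) ≠ 0 := by exact_mod_cast hk'.ne'
  have := clock_sum hα hαβ hp h1 h2 h3 f (d := d) (fun n => rfl) k
  rw [this]
  simp only [Function.comp]
  field_simp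
  ring

/-- The averages over the times between consecutive rings of two clocks with incommensurable
periods converge. -/
theorem tendsto_clock_average {α β : ℝ} {p : ℕ → ℝ × ℝ} (hα : 0 < α) (hβ : 0 < β)
    (hirr : ∀ n : ℤ, n ≠ 0 → ∀ m : ℤ, n * β ≠ m * α)
    (hp : ∀ k, p (k + 1) = clockStep α β (p k))
    (h1 : (p 0).1 ∈ Set.Icc 0 α) (h2 : (p 0).2 ∈ Set.Icc 0 β) {f : ℝ → ℝ} (hf : Continuous f)
    {C : ℝ} (hC : ∀ t, |f t| ≤ C) :
    Tendsto (fun n : ℕ => (n : ℝ)⁻¹ *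
      ∑ k ∈ Finset.range n, f (min (p (k + 1)).1 (p (k + 1)).2)) atTop (𝓝 (clockMean α β f)) := by
  -- The initial readings may vanish or violate the invariant; one step repairs both, hence the
  -- shift to `k + 1`.
  have hm := clockStep_mem hα hβ h1 h2
  rw [← hp] at hm
  rcases le_total α β with h | h
  · refine tendsto_clock_average_of_le (p := fun k => p (k + 1)) hα h hirr (fun k => hp _)
      hm.1 hm.2 ?_ hf hC
    simp only [zero_add]
    rw [hp]
    exact clockStep_eq_or_le h h1 h2
  · have key := tendsto_clock_average_of_le (p := fun k => (p (k + 1)).swap) hβ h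
      (fun n hn m e => by
        rcases eq_or_ne m 0 with rfl | hm0
        · have : (n : ℝ) ≠ 0 := by exact_mod_cast hn
          have := mul_ne_zero this hα.ne'
          simp_all
        · exact hirr m hm0 n e.symm)
      (fun k => by rw [hp (k + 1), clockStep_swap])
      hm.2 hm.1 (by
        simp only [zero_add, Prod.fst_swap, Prod.snd_swap]
        rw [hp]
        exact clockStep_eq_or_le (p := (p 0).swap) h h2 h1) hf hC
    rw [clockMean_swap] at key
    simpa only [Prod.fst_swap, Prod.snd_swap, min_comm] using key

/-! ### The billiard in a box as a pair of clocks -/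

noncomputable section

/-- The time until a point of `[0,L]` at `x` with velocity `w` reaches the end of the interval. -/
def wallTime (L x w : ℝ) : ℝ := if 0 < w then (L - x) / w else x / (-w)

/-- The times until a particle reaches the next wall of either direction. -/
def wallClocks (a b : ℝ) (s : Plane × Plane) : ℝ × ℝ :=
  (wallTime a (s.1 0) (s.2 0), wallTime b (s.1 1) (s.2 1))

/-- The states in the box with a velocity that is not parallel to a wall. -/
def transverseStates (a b : ℝ) : Set (Plane × Plane) :=
  {s | s.1 ∈ box a b ∧ s.2 0 ≠ 0 ∧ s.2 1 ≠ 0}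

/-- A globally measurable map that agrees with `bounceMap` on the transverse states. -/
def clockBounceMap (a b : ℝ) (s : Plane × Plane) : Plane × Plane :=
  let q : Plane := s.1 + min (wallClocks a b s).1 (wallClocks a b s).2 • s.2
  (q, !₂[reflectCoord a (q 0) (s.2 0), reflectCoord b (q 1) (s.2 1)])

end

section coordinate

variable {L x w t : ℝ}

lemma wallTime_mem (hx : x ∈ Set.Icc 0 L) (hw : w ≠ 0) :
    wallTime L x w ∈ Set.Icc 0 (L / |w|) := by
  obtain ⟨h0, h1⟩ := hx
  unfold wallTime
  split_ifs with h
  · rw [abs_of_pos h]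
    exact ⟨div_nonneg (by linarith) h.le, by gcongr; linarith⟩
  · have hw' : w < 0 := lt_of_le_of_ne (not_lt.1 h) hw
    rw [abs_of_neg hw']
    have : 0 < -w := by linarith
    exact ⟨div_nonneg h0 this.le, by gcongr⟩

lemma add_mul_mem_Icc_iff (hx : x ∈ Set.Icc 0 L) (hw : w ≠ 0) (ht : 0 ≤ t) :
    x + t * w ∈ Set.Icc 0 L ↔ t ≤ wallTime L x w := by
  obtain ⟨h0, h1⟩ := hx
  unfold wallTime
  split_ifs with h
  · rw [le_div_iff₀ h, Set.mem_Icc]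
    have := mul_nonneg ht h.le
    constructor
    · rintro ⟨_, h⟩; linarith
    · intro h; constructor <;> linarith
  · have hw' : 0 < -w := by have := lt_of_le_of_ne (not_lt.1 h) hw; linarith
    rw [le_div_iff₀ hw', Set.mem_Icc]
    have := mul_nonneg ht hw'.le
    constructor
    · rintro ⟨h, _⟩; linarith
    · intro h; constructor <;> linarith

lemma abs_reflectCoord : |reflectCoord L x w| = |w| := by
  unfold reflectCoord
  split_ifs <;> simp

lemma reflectCoord_ne_zero (hw : w ≠ 0) : reflectCoord L x w ≠ 0 := by
  rw [← abs_pos, abs_reflectCoord, abs_pos]; exact hw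

/-- At the wall the velocity turns inwards, and the whole width `L` lies ahead. -/
lemma wallTime_reflect_of_eq (hw : w ≠ 0) :
    wallTime L (x + wallTime L x w * w) (reflectCoord L (x + wallTime L x w * w) w)
      = L / |w| := by
  rcases lt_or_gt_of_ne hw with h | h
  · have e : x + wallTime L x w * w = 0 := by
      rw [wallTime, if_neg h.not_gt]; field_simp; ring
    rw [e, reflectCoord, if_pos (Or.inl ⟨rfl, h⟩), wallTime, if_pos (by linarith), abs_of_neg h,
      sub_zero]
  · have e : x + wallTime L x w * w = L := by
      rw [wallTime, if_pos h]; field_simp; ring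
    rw [e, reflectCoord, if_pos (Or.inr ⟨rfl, h⟩), wallTime, if_neg (by linarith), abs_of_pos h,
      neg_neg]

/-- The wall ahead is not yet reached, and a particle sitting at the wall behind moves away from it,
so nothing is reflected. -/
lemma wallTime_reflect_of_lt (hw : w ≠ 0) (ht : t < wallTime L x w) :
    wallTime L (x + t * w) (reflectCoord L (x + t * w) w) = wallTime L x w - t := by
  rcases lt_or_gt_of_ne hw with h | h
  · have h' : 0 < -w := by linarith
    have hpos : 0 < x + t * w := by
      rw [wallTime, if_neg h.not_gt, lt_div_iff₀ h'] at ht; linarith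
    rw [reflectCoord, if_neg, wallTime, if_neg h.not_gt, wallTime, if_neg h.not_gt]
    · field_simp; ring
    · rintro (⟨h1, -⟩ | ⟨-, h2⟩)
      · exact hpos.ne' h1
      · exact h.not_gt h2
  · have hpos : x + t * w < L := by
      rw [wallTime, if_pos h, lt_div_iff₀ h] at ht; linarith
    rw [reflectCoord, if_neg, wallTime, if_pos h, wallTime, if_pos h]
    · field_simp; ring
    · rintro (⟨-, h2⟩ | ⟨h1, -⟩)
      · exact h.not_gt h2
      · exact hpos.ne h1

end coordinate

section states

variable {a b : ℝ} {s : Plane × Plane}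

lemma wallClocks_mem (hs : s ∈ transverseStates a b) :
    (wallClocks a b s).1 ∈ Set.Icc 0 (a / |s.2 0|) ∧
      (wallClocks a b s).2 ∈ Set.Icc 0 (b / |s.2 1|) :=
  ⟨wallTime_mem hs.1.1 hs.2.1, wallTime_mem hs.1.2 hs.2.2⟩

/-- The box is a product of intervals, so the admissible times are those admissible for both
coordinates. -/
lemma flightTime_eq_min (hs : s ∈ transverseStates a b) :
    flightTime a b s = min (wallClocks a b s).1 (wallClocks a b s).2 := by
  obtain ⟨⟨h1, -⟩, h2, -⟩ := wallClocks_mem hs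
  have e : {r : ℝ | 0 ≤ r ∧ s.1 + r • s.2 ∈ box a b}
      = Set.Icc 0 (min (wallClocks a b s).1 (wallClocks a b s).2) := by
    ext r
    simp only [Set.mem_ofPred_eq, box, PiLp.add_apply, PiLp.smul_apply, smul_eq_mul, Set.mem_Icc,
      le_min_iff, wallClocks]
    refine and_congr_right fun hr => ?_
    rw [← add_mul_mem_Icc_iff hs.1.1 hs.2.1 hr, ← add_mul_mem_Icc_iff hs.1.2 hs.2.2 hr]
    rfl
  rw [flightTime, e, csSup_Icc (le_min h1 h2)]

lemma bounceMap_eq (hs : s ∈ transverseStates a b) : bounceMap a b s = clockBounceMap a b s := by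
  simp only [bounceMap, clockBounceMap, flightTime_eq_min hs]

lemma clockBounceMap_mem (hs : s ∈ transverseStates a b) :
    clockBounceMap a b s ∈ transverseStates a b := by
  obtain ⟨⟨h1, -⟩, h2, -⟩ := wallClocks_mem hs
  have h0 := le_min h1 h2
  refine ⟨⟨?_, ?_⟩, reflectCoord_ne_zero hs.2.1, reflectCoord_ne_zero hs.2.2⟩
  · exact (add_mul_mem_Icc_iff hs.1.1 hs.2.1 h0).2 (min_le_left _ _)
  · exact (add_mul_mem_Icc_iff hs.1.2 hs.2.2 h0).2 (min_le_right _ _)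

lemma abs_clockBounceMap_zero : |(clockBounceMap a b s).2 0| = |s.2 0| := abs_reflectCoord

lemma abs_clockBounceMap_one : |(clockBounceMap a b s).2 1| = |s.2 1| := abs_reflectCoord

/-- A bounce resets exactly the clocks that have run down, in a corner both. The periods stay the
same along the orbit because reflections preserve the speeds |v₀| and |v₁|. -/
lemma wallClocks_clockBounceMap (hs : s ∈ transverseStates a b) :
    wallClocks a b (clockBounceMap a b s)
      = clockStep (a / |s.2 0|) (b / |s.2 1|) (wallClocks a b s) := by
  refine Prod.ext ?_ ?_
  · change wallTime a (s.1 0 + min (wallClocks a b s).1 (wallClocks a b s).2 * s.2 0)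
      (reflectCoord a (s.1 0 + min (wallClocks a b s).1 (wallClocks a b s).2 * s.2 0) (s.2 0)) = _
    simp only [clockStep]
    split_ifs with h
    · rw [min_eq_left h]
      exact wallTime_reflect_of_eq hs.2.1
    · rw [not_le] at h
      rw [min_eq_right h.le]
      exact wallTime_reflect_of_lt hs.2.1 h
  · change wallTime b (s.1 1 + min (wallClocks a b s).1 (wallClocks a b s).2 * s.2 1)
      (reflectCoord b (s.1 1 + min (wallClocks a b s).1 (wallClocks a b s).2 * s.2 1) (s.2 1)) = _
    simp only [clockStep]
    split_ifs with h
    · rw [min_eq_right h]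
      exact wallTime_reflect_of_eq hs.2.2
    · rw [not_le] at h
      rw [min_eq_left h.le]
      exact wallTime_reflect_of_lt hs.2.2 h

lemma iterate_bounceMap_eq (hs : s ∈ transverseStates a b) (k : ℕ) :
    (bounceMap a b)^[k] s = (clockBounceMap a b)^[k] s ∧
      (clockBounceMap a b)^[k] s ∈ transverseStates a b ∧
      |((clockBounceMap a b)^[k] s).2 0| = |s.2 0| ∧
      |((clockBounceMap a b)^[k] s).2 1| = |s.2 1| := by
  induction k with
  | zero => exact ⟨rfl, hs, rfl, rfl⟩
  | succ k ih =>
    obtain ⟨h1, h2, h3, h4⟩ := ih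
    rw [Function.iterate_succ_apply', Function.iterate_succ_apply', h1, bounceMap_eq h2]
    exact ⟨rfl, clockBounceMap_mem h2, abs_clockBounceMap_zero.trans h3,
      abs_clockBounceMap_one.trans h4⟩

lemma norm_plane_sq (v : Plane) : ‖v‖ ^ 2 = |v 0| ^ 2 + |v 1| ^ 2 := by
  rw [EuclideanSpace.norm_sq_eq, Fin.sum_univ_two]; rfl

lemma bounceLength_eq_min (hs : s ∈ transverseStates a b) (hv : ‖s.2‖ = 1) (k : ℕ) :
    bounceLength a b s k = min (wallClocks a b ((clockBounceMap a b)^[k + 1] s)).1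
      (wallClocks a b ((clockBounceMap a b)^[k + 1] s)).2 := by
  obtain ⟨h1, h2, h3, h4⟩ := iterate_bounceMap_eq hs (k + 1)
  set u := (clockBounceMap a b)^[k + 1] s with hu
  have hn : ‖u.2‖ = 1 := by
    have := norm_plane_sq u.2
    rw [h3, h4, ← norm_plane_sq, hv, one_pow] at this
    exact (pow_eq_one_iff_of_nonneg (norm_nonneg _) two_ne_zero).1 this
  obtain ⟨⟨c1, -⟩, c2, -⟩ := wallClocks_mem h2
  have e : bouncePoint a b s (k + 2)
      = u.1 + min (wallClocks a b u).1 (wallClocks a b u).2 • u.2 := by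
    rw [bouncePoint, Function.iterate_succ_apply', h1, bounceMap_eq h2]; rfl
  rw [bounceLength, e, bouncePoint, h1, dist_self_add_right, norm_smul, hn, mul_one,
    Real.norm_of_nonneg (le_min c1 c2)]

/-- Along a direction of irrational slope the averages over the bounce lengths converge. -/
theorem tendsto_bounceLength_average (ha : 0 < a) (hb : 0 < b) (hs : s ∈ transverseStates a b)
    (hv : ‖s.2‖ = 1)
    (hirr : ∀ n : ℤ, n ≠ 0 → ∀ m : ℤ, n * (b / |s.2 1|) ≠ m * (a / |s.2 0|))
    {f : ℝ → ℝ} (hf : Continuous f) {C : ℝ} (hC : ∀ t, |f t| ≤ C) :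
    Tendsto (fun n : ℕ => (n : ℝ)⁻¹ * ∑ k ∈ Finset.range n, f (bounceLength a b s k))
      atTop (𝓝 (clockMean (a / |s.2 0|) (b / |s.2 1|) f)) := by
  simp only [bounceLength_eq_min hs hv]
  have hα : 0 < a / |s.2 0| := div_pos ha (abs_pos.2 hs.2.1)
  have hβ : 0 < b / |s.2 1| := div_pos hb (abs_pos.2 hs.2.2)
  refine tendsto_clock_average (p := fun k => wallClocks a b ((clockBounceMap a b)^[k] s))
    hα hβ hirr (fun k => ?_) (wallClocks_mem hs).1 (wallClocks_mem hs).2 hf hC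
  obtain ⟨-, h2, h3, h4⟩ := iterate_bounceMap_eq hs k
  rw [Function.iterate_succ_apply', wallClocks_clockBounceMap h2, h3, h4]

end states

/-! ### Measurability of the bounce lengths -/

section measurability

lemma measurable_wallTime (L : ℝ) : Measurable fun p : ℝ × ℝ => wallTime L p.1 p.2 := by
  unfold wallTime
  exact Measurable.ite (measurableSet_lt measurable_const measurable_snd) (by fun_prop)
    (by fun_prop)

lemma measurable_reflectCoord (L : ℝ) : Measurable fun p : ℝ × ℝ => reflectCoord L p.1 p.2 := by
  unfold reflectCoord
  refine Measurable.ite ?_ (by fun_prop) (by fun_prop)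
  exact ((measurableSet_eq_fun measurable_fst measurable_const).inter
    (measurableSet_lt measurable_snd measurable_const)).union
    ((measurableSet_eq_fun measurable_fst measurable_const).inter
    (measurableSet_lt measurable_const measurable_snd))

lemma measurable_wallClocks (a b : ℝ) : Measurable (wallClocks a b) :=
  ((measurable_wallTime a).comp (f := fun s : Plane × Plane => (s.1 0, s.2 0)) (by fun_prop)).prodMk
    ((measurable_wallTime b).comp (f := fun s : Plane × Plane => (s.1 1, s.2 1)) (by fun_prop))

lemma measurable_clockBounceMap (a b : ℝ) : Measurable (clockBounceMap a b) := by
  have hc := measurable_wallClocks a b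
  have hq : Measurable fun s : Plane × Plane =>
      s.1 + min (wallClocks a b s).1 (wallClocks a b s).2 • s.2 :=
    measurable_fst.add ((hc.fst.min hc.snd).smul measurable_snd)
  refine hq.prodMk ?_
  refine (WithLp.measurable_toLp 2 (Fin 2 → ℝ)).comp (measurable_pi_lambda _ fun i => ?_)
  fin_cases i
  · exact (measurable_reflectCoord a).comp (f := fun s : Plane × Plane =>
      ((s.1 + min (wallClocks a b s).1 (wallClocks a b s).2 • s.2) 0, s.2 0)) (by fun_prop)
  · exact (measurable_reflectCoord b).comp (f := fun s : Plane × Plane =>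
      ((s.1 + min (wallClocks a b s).1 (wallClocks a b s).2 • s.2) 1, s.2 1)) (by fun_prop)

/-- The flight time is a supremum over an uncountable set; measurability comes from the clock
description, which agrees with it on the transverse states. -/
lemma aemeasurable_bounceLength {a b : ℝ} {ρ : Measure (Plane × Plane)}
    (hρ : ∀ᵐ s ∂ρ, s ∈ transverseStates a b) (k : ℕ) :
    AEMeasurable (fun s => bounceLength a b s k) ρ := by
  have hm := measurable_clockBounceMap a b
  refine ⟨fun s => dist ((clockBounceMap a b)^[k + 1] s).1 ((clockBounceMap a b)^[k + 2] s).1,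
    (hm.iterate _).fst.dist (hm.iterate _).fst, ?_⟩
  filter_upwards [hρ] with s hs
  simp only [bounceLength, bouncePoint, (iterate_bounceMap_eq hs _).1]

end measurability

/-! ### The closed form of the density -/

noncomputable section

/-- The density contributed by the flights between two opposite walls at distance `a`. -/
def crossingDensity (a b t : ℝ) : ℝ :=
  a * (b - √(t ^ 2 - a ^ 2)) / (t * (b + √(t ^ 2 - a ^ 2)) * √(t ^ 2 - a ^ 2))

/-- The rate with which walls at distance `a` admit shorter flights, as a function of the length of
the flight between these walls. -/
def cornerRate (a b T : ℝ) : ℝ :=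
  2 * a / (b + √(T ^ 2 - a ^ 2)) * (1 / T ^ 2)

/-- A primitive of `-cornerRate a b` on the lengths above `a`. -/
def cornerPrimitive (a b t : ℝ) : ℝ :=
  (2 * a * b - 2 * a * √(t ^ 2 - a ^ 2)) / (t * (a ^ 2 + b ^ 2))
    + 2 * a * b / √(a ^ 2 + b ^ 2) ^ 3
      * (Real.log (t * b + √(t ^ 2 - a ^ 2) * √(a ^ 2 + b ^ 2)) - Real.log (√(a ^ 2 + b ^ 2) + t))

end

section calculus

variable {a b t : ℝ}

lemma sqrt_diag_pos (ha : 0 < a) : 0 < √(a ^ 2 + b ^ 2) := Real.sqrt_pos.2 (by positivity)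

lemma lt_sqrt_diag (hb : 0 < b) : a < √(a ^ 2 + b ^ 2) :=
  Real.lt_sqrt_of_sq_lt (by have := pow_pos hb 2; linarith)

lemma lt_sqrt_diag' (ha : 0 < a) : b < √(a ^ 2 + b ^ 2) :=
  Real.lt_sqrt_of_sq_lt (by have := pow_pos ha 2; linarith)

lemma sq_sqrt_diag : √(a ^ 2 + b ^ 2) ^ 2 = a ^ 2 + b ^ 2 := Real.sq_sqrt (by positivity)

lemma sqrt_leg_sq (ha : 0 < a) (hat : a ≤ t) : √(t ^ 2 - a ^ 2) ^ 2 = t ^ 2 - a ^ 2 :=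
  Real.sq_sqrt (by nlinarith)

lemma sqrt_leg_lt (ha : 0 < a) (hb : 0 < b) (hat : a ≤ t) (htr : t < √(a ^ 2 + b ^ 2)) :
    √(t ^ 2 - a ^ 2) < b := by
  rw [Real.sqrt_lt' hb]
  have := (Real.lt_sqrt (by linarith)).1 htr
  linarith

lemma cornerRate_nonneg (ha : 0 < a) (hb : 0 < b) : 0 ≤ cornerRate a b t := by
  unfold cornerRate; positivity

lemma crossingDensity_nonneg (ha : 0 < a) (hb : 0 < b) (hat : a < t)
    (htr : t < √(a ^ 2 + b ^ 2)) : 0 ≤ crossingDensity a b t := by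
  have := sqrt_leg_lt ha hb hat.le htr
  have ht : 0 < t := ha.trans hat
  unfold crossingDensity
  exact div_nonneg (mul_nonneg ha.le (by linarith)) (by positivity)

lemma continuousOn_cornerRate (hb : 0 < b) : ContinuousOn (cornerRate a b) (Set.Ioi 0) := by
  unfold cornerRate
  refine ContinuousOn.mul (ContinuousOn.div (by fun_prop) (by fun_prop) fun t _ => by positivity)
    (ContinuousOn.div (by fun_prop) (by fun_prop) fun t ht => ?_)
  exact pow_ne_zero _ (ne_of_gt ht)

lemma intervalIntegrable_cornerRate (hb : 0 < b) {x y : ℝ} (hx : 0 < x) (hy : 0 < y) :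
    IntervalIntegrable (cornerRate a b) volume x y :=
  ((continuousOn_cornerRate hb).mono fun _ hz => (lt_min hx hy).trans_le hz.1).intervalIntegrable

lemma hasDerivAt_cornerPrimitive (ha : 0 < a) (hb : 0 < b) (hat : a < t) :
    HasDerivAt (cornerPrimitive a b) (-cornerRate a b t) t := by
  have ht : 0 < t := ha.trans hat
  have hr := sqrt_diag_pos (b := b) ha
  have hr2 := sq_sqrt_diag (a := a) (b := b)
  have hu2 := sqrt_leg_sq ha hat.le
  have hpos : 0 < t ^ 2 - a ^ 2 := by nlinarith
  have hu : 0 < √(t ^ 2 - a ^ 2) := Real.sqrt_pos.2 hpos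
  have du : HasDerivAt (fun t => √(t ^ 2 - a ^ 2)) (t / √(t ^ 2 - a ^ 2)) t := by
    have := (((hasDerivAt_id t).pow 2).sub_const (a ^ 2)).sqrt hpos.ne'
    refine this.congr_deriv ?_
    simp only [id, Pi.pow_apply]
    field_simp
    push_cast
    ring
  unfold cornerRate cornerPrimitive
  set r := √(a ^ 2 + b ^ 2) with hrdef
  set u := √(t ^ 2 - a ^ 2) with hudef
  have hR : 0 < a ^ 2 + b ^ 2 := by positivity
  have d1 := ((du.const_mul (2 * a)).const_sub (2 * a * b)).div
    ((hasDerivAt_id t).mul_const (a ^ 2 + b ^ 2)) (by simp only [id]; positivity)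
  have hl : 0 < t * b + u * r := by positivity
  have d2 := (((hasDerivAt_id t).mul_const b).add (du.mul_const r)).log hl.ne'
  have d3 := ((hasDerivAt_id t).const_add r).log (by simp only [id]; positivity)
  have d4 := d1.add ((d2.sub d3).const_mul (2 * a * b / r ^ 3))
  refine d4.congr_deriv ?_
  simp only [id, one_mul, Pi.add_apply]
  -- This identity, valid since r² = a² + b² and u² = t² - a², collapses the derivative of log ((t b
  -- + u r) / (r + t)) to r / (u (b + u)).
  have key : (b * u + r * t + a ^ 2) * (b + u) = (t * b + u * r) * (r + t) := by
    linear_combination (-u) * hr2 + b * hu2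
  have e1 : (b + t / u * r) / (t * b + u * r) - 1 / (r + t) = r / (u * (b + u)) := by
    rw [div_sub_div _ _ hl.ne' (by positivity), div_eq_div_iff (by positivity) (by positivity)]
    field_simp
    linear_combination r * key + (- r * b - r * u) * hu2
  rw [e1]
  field_simp
  rw [← hr2]
  field_simp
  linear_combination u * (hr2 + hu2)

lemma continuousOn_cornerPrimitive (ha : 0 < a) (hb : 0 < b) :
    ContinuousOn (cornerPrimitive a b) (Set.Ioi 0) := by
  have hr := sqrt_diag_pos (b := b) ha
  unfold cornerPrimitive
  refine ContinuousOn.add (ContinuousOn.div (by fun_prop) (by fun_prop) fun t ht => ?_)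
    (continuousOn_const.mul (ContinuousOn.sub (ContinuousOn.log (by fun_prop) fun t ht => ?_)
      (ContinuousOn.log (by fun_prop) fun t ht => ?_)))
  · have : 0 < t := ht
    positivity
  · have : 0 < t := ht
    positivity
  · have : 0 < t := ht
    positivity

/-- The square root is not differentiable at t = a, so the fundamental theorem is used with a
primitive that is continuous up to the ends and differentiable inside. -/
lemma integral_cornerRate (ha : 0 < a) (hb : 0 < b) (hat : a ≤ t) (htr : t ≤ √(a ^ 2 + b ^ 2)) :
    ∫ T in t..√(a ^ 2 + b ^ 2), cornerRate a b T
      = cornerPrimitive a b t - 2 * a * b / √(a ^ 2 + b ^ 2) ^ 3 * Real.log b := by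
  have ht : 0 < t := ha.trans_le hat
  have hr := sqrt_diag_pos (b := b) ha
  have h := intervalIntegral.integral_eq_sub_of_hasDerivAt_of_le htr
    ((continuousOn_cornerPrimitive ha hb).mono fun x hx => ht.trans_le hx.1)
    (fun x hx => hasDerivAt_cornerPrimitive ha hb (hat.trans_lt hx.1))
    (intervalIntegrable_cornerRate hb ht hr).neg
  rw [intervalIntegral.integral_neg] at h
  have hval : cornerPrimitive a b √(a ^ 2 + b ^ 2)
      = 2 * a * b / √(a ^ 2 + b ^ 2) ^ 3 * Real.log b := by
    have hu : √(√(a ^ 2 + b ^ 2) ^ 2 - a ^ 2) = b := by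
      rw [sq_sqrt_diag, add_sub_cancel_left, Real.sqrt_sq hb.le]
    rw [cornerPrimitive, hu, sub_self, zero_div, zero_add]
    congr 1
    rw [← Real.log_div (by positivity) (by positivity)]
    congr 1
    field_simp
  rw [← hval]
  linarith

/-- Both terms blow up as t → r, but (t b - u r)(t b + u r) = a² (r - t)(r + t), so the singular
logarithms cancel. -/
lemma artanh_sub_artanh (ha : 0 < a) (hb : 0 < b) (hat : a ≤ t) (htr : t < √(a ^ 2 + b ^ 2)) :
    Real.artanh (√(t ^ 2 - a ^ 2) * √(a ^ 2 + b ^ 2) / (t * b))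
        - Real.artanh (t / √(a ^ 2 + b ^ 2))
      = Real.log (t * b + √(t ^ 2 - a ^ 2) * √(a ^ 2 + b ^ 2))
        - Real.log (√(a ^ 2 + b ^ 2) + t) - Real.log a := by
  have ht : 0 < t := ha.trans_le hat
  have hr := sqrt_diag_pos (b := b) ha
  have hr2 := sq_sqrt_diag (a := a) (b := b)
  have hu2 := sqrt_leg_sq ha hat
  have hu0 := Real.sqrt_nonneg (t ^ 2 - a ^ 2)
  set r := √(a ^ 2 + b ^ 2)
  set u := √(t ^ 2 - a ^ 2)
  have hrt : 0 < r - t := by linarith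
  have hp : 0 < t * b + u * r := by positivity
  have hm : (t * b - u * r) * (t * b + u * r) = a ^ 2 * ((r - t) * (r + t)) := by
    linear_combination (-u ^ 2 - a ^ 2) * hr2 + (- a ^ 2 - b ^ 2) * hu2
  have hm0 : 0 < t * b - u * r := by
    have : 0 < a ^ 2 * ((r - t) * (r + t)) := by positivity
    rw [← hm] at this
    exact pos_of_mul_pos_left this hp.le
  have hlog : Real.log (t * b - u * r) + Real.log (t * b + u * r)
      = 2 * Real.log a + (Real.log (r - t) + Real.log (r + t)) := by
    rw [← Real.log_mul hm0.ne' hp.ne', hm, Real.log_mul (by positivity) (by positivity),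
      Real.log_mul hrt.ne' (by positivity), Real.log_pow]
    norm_num
  have htb : 0 < t * b := by positivity
  rw [Real.artanh_eq_half_log ⟨by have : 0 ≤ u * r / (t * b) := by positivity
                                  linarith, by rw [div_le_one htb]; linarith⟩,
    Real.artanh_eq_half_log ⟨by have : 0 ≤ t / r := by positivity
                                linarith, by rw [div_le_one hr]; linarith⟩]
  have e1 : (1 + u * r / (t * b)) / (1 - u * r / (t * b))
      = (t * b + u * r) / (t * b - u * r) := by
    field_simp
  have e2 : (1 + t / r) / (1 - t / r) = (r + t) / (r - t) := by
    field_simp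
  rw [e1, e2, Real.log_div hp.ne' hm0.ne', Real.log_div (by positivity) hrt.ne']
  linarith

/-- The remainder log a - log b is antisymmetric in the two side lengths and disappears when both
pairs of walls are added. -/
lemma integral_cornerRate_eq_artanh (ha : 0 < a) (hb : 0 < b) (hat : a ≤ t)
    (htr : t < √(a ^ 2 + b ^ 2)) :
    ∫ T in t..√(a ^ 2 + b ^ 2), cornerRate a b T
      = (2 * a * b - 2 * a * √(t ^ 2 - a ^ 2)) / (t * (a ^ 2 + b ^ 2))
        + 2 * a * b / √(a ^ 2 + b ^ 2) ^ 3
          * (Real.artanh (√(t ^ 2 - a ^ 2) * √(a ^ 2 + b ^ 2) / (t * b))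
            - Real.artanh (t / √(a ^ 2 + b ^ 2)) + (Real.log a - Real.log b)) := by
  rw [artanh_sub_artanh ha hb hat htr, integral_cornerRate ha hb hat htr.le, cornerPrimitive]
  ring

/-- The value at the left end, where the flights are perpendicular to the walls. -/
lemma integral_cornerRate_self (ha : 0 < a) (hb : 0 < b) :
    ∫ T in a..√(a ^ 2 + b ^ 2), cornerRate a b T
      = 2 * b / (a ^ 2 + b ^ 2) + 2 * a * b / √(a ^ 2 + b ^ 2) ^ 3
          * (- Real.artanh (a / √(a ^ 2 + b ^ 2)) + (Real.log a - Real.log b)) := by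
  rw [integral_cornerRate_eq_artanh ha hb le_rfl (lt_sqrt_diag hb)]
  simp only [sub_self, Real.sqrt_zero, zero_mul, zero_div, Real.artanh_zero, zero_sub, mul_zero,
    sub_zero]
  congr 1
  field_simp

end calculus

lemma rpow_three_halves {x : ℝ} (hx : 0 ≤ x) : x ^ (3 / 2 : ℝ) = √x ^ 3 := by
  rw [Real.sqrt_eq_rpow, ← Real.rpow_natCast, ← Real.rpow_mul hx]
  norm_num

lemma singularPart_eq (a b t : ℝ) : singularPart a b t = 2 / Real.pi *
    ((if a < t then crossingDensity a b t else 0)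
      + (if b < t then crossingDensity b a t else 0)) := by
  simp only [singularPart, crossingDensity]

lemma smoothPart_eq (a b t : ℝ) : smoothPart a b t = 2 / Real.pi *
    ((∫ T in (max a t)..(√(a ^ 2 + b ^ 2)), cornerRate a b T)
      + ∫ T in (max b t)..(√(b ^ 2 + a ^ 2)), cornerRate b a T) := by
  simp only [smoothPart, cornerRate, add_comm (b ^ 2) (a ^ 2)]

/-- The three ranges differ in which of max(a, t) and max(b, t) equals t. A maximum that does not
equal t contributes the constant of `integral_cornerRate_self`. -/
theorem absorptionPDF_eq_add {a b t : ℝ} (ha : 0 < a) (hab : a ≤ b) (ht : 0 < t)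
    (htr : t < √(a ^ 2 + b ^ 2)) (hta : t ≠ a) (htb : t ≠ b) :
    absorptionPDF a b t = singularPart a b t + smoothPart a b t := by
  have hb : 0 < b := ha.trans_le hab
  have hr := sqrt_diag_pos (b := b) ha
  have hR : 0 < a ^ 2 + b ^ 2 := by positivity
  have hc := add_comm (b ^ 2) (a ^ 2)
  rw [singularPart_eq, smoothPart_eq, ← mul_add, absorptionPDF]
  have hself := integral_cornerRate_self hb ha
  rw [hc] at hself
  rcases lt_or_gt_of_ne hta with h1 | h1
  · rw [if_pos ⟨ht, h1⟩, if_neg h1.not_gt, if_neg (h1.trans_le hab).not_gt, max_eq_left h1.le,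
      max_eq_left (h1.le.trans hab), integral_cornerRate_self ha hb, hc, hself,
      rpow_three_halves hR.le]
    congr 1
    ring
  · rw [if_neg (fun h => h.2.not_gt h1), if_pos h1, max_eq_right h1.le,
      integral_cornerRate_eq_artanh ha hb h1.le htr]
    rcases lt_or_gt_of_ne htb with h2 | h2
    · rw [if_pos ⟨h1, h2⟩, if_neg h2.not_gt, max_eq_left h2.le, hc, hself,
        rpow_three_halves hR.le, crossingDensity]
      congr 1
      field_simp
      ring
    · rw [if_neg (fun h => h.2.not_gt h2), if_pos ⟨h2, htr⟩, if_pos h2, max_eq_right h2.le,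
        integral_cornerRate_eq_artanh hb ha h2.le (by rwa [hc]), hc,
        rpow_three_halves hR.le, crossingDensity, crossingDensity]
      congr 1
      ring

lemma absorptionPDF_eq_zero {a b t : ℝ} (ha : 0 < a) (hab : a ≤ b)
    (h : t ≤ 0 ∨ √(a ^ 2 + b ^ 2) ≤ t ∨ t = a ∨ t = b) : absorptionPDF a b t = 0 := by
  have hb : 0 < b := ha.trans_le hab
  have h1 := lt_sqrt_diag (a := a) hb
  have h2 := lt_sqrt_diag' (b := b) ha
  unfold absorptionPDF
  rw [if_neg, if_neg, if_neg]
  · rintro ⟨h3, h4⟩; rcases h with h | h | h | h <;> linarith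
  · rintro ⟨h3, h4⟩; rcases h with h | h | h | h <;> linarith
  · rintro ⟨h3, h4⟩; rcases h with h | h | h | h <;> linarith

/-- The sign is invisible in the closed form but evident in the decomposition, where √(t² - a²) < b
below the diagonal length. -/
theorem absorptionPDF_nonneg {a b : ℝ} (ha : 0 < a) (hab : a ≤ b) (t : ℝ) :
    0 ≤ absorptionPDF a b t := by
  have hb : 0 < b := ha.trans_le hab
  by_cases h : t ≤ 0 ∨ √(a ^ 2 + b ^ 2) ≤ t ∨ t = a ∨ t = b
  · exact (absorptionPDF_eq_zero ha hab h).ge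
  push Not at h
  obtain ⟨h0, hr, h1, h2⟩ := h
  rw [absorptionPDF_eq_add ha hab h0 hr h1 h2, singularPart_eq, smoothPart_eq]
  have hr' : t < √(b ^ 2 + a ^ 2) := by rwa [add_comm]
  have i1 : 0 ≤ ∫ T in (max a t)..(√(a ^ 2 + b ^ 2)), cornerRate a b T :=
    intervalIntegral.integral_nonneg (max_le (lt_sqrt_diag hb).le hr.le)
      fun _ _ => cornerRate_nonneg ha hb
  have i2 : 0 ≤ ∫ T in (max b t)..(√(b ^ 2 + a ^ 2)), cornerRate b a T :=
    intervalIntegral.integral_nonneg (max_le (lt_sqrt_diag ha).le hr'.le)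
      fun _ _ => cornerRate_nonneg hb ha
  have i3 : 0 ≤ if a < t then crossingDensity a b t else 0 := by
    split_ifs with h
    · exact crossingDensity_nonneg ha hb h hr
    · rfl
  have i4 : 0 ≤ if b < t then crossingDensity b a t else 0 := by
    split_ifs with h
    · exact crossingDensity_nonneg hb ha h hr'
    · rfl
  have := Real.pi_pos
  positivity

/-! ### The average over the directions -/

section crossing

variable {a b : ℝ}

lemma hasDerivAt_arccos_div (ha : 0 < a) {T : ℝ} (hT : a < T) :
    HasDerivAt (fun T => Real.arccos (a / T)) (a / (T * √(T ^ 2 - a ^ 2))) T := by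
  have hT0 : 0 < T := ha.trans hT
  have h1 : a / T < 1 := (div_lt_one hT0).2 hT
  have h0 : 0 < a / T := div_pos ha hT0
  have hd : HasDerivAt (fun T => a / T) (-a / T ^ 2) T := by
    have := (hasDerivAt_const T a).div (hasDerivAt_id T) hT0.ne'
    refine this.congr_deriv ?_
    simp
  have := (Real.hasDerivAt_arccos (by linarith) h1.ne).comp T hd
  refine this.congr_deriv ?_
  have e : √(1 - (a / T) ^ 2) = √(T ^ 2 - a ^ 2) / T := by
    rw [show 1 - (a / T) ^ 2 = (T ^ 2 - a ^ 2) / T ^ 2 by field_simp,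
      Real.sqrt_div (by nlinarith), Real.sqrt_sq hT0.le]
  have hu : 0 < √(T ^ 2 - a ^ 2) := Real.sqrt_pos.2 (by nlinarith)
  rw [e]
  field_simp

lemma injOn_arccos_div (ha : 0 < a) (r : ℝ) :
    Set.InjOn (fun T => Real.arccos (a / T)) (Set.Ioo a r) := by
  intro x hx y hy hxy
  have hx0 : 0 < x := ha.trans hx.1
  have hy0 : 0 < y := ha.trans hy.1
  have h1 : a / x ≤ 1 := (div_le_one hx0).2 hx.1.le
  have h2 : a / y ≤ 1 := (div_le_one hy0).2 hy.1.le
  have h3 : 0 < a / x := div_pos ha hx0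
  have h4 : 0 < a / y := div_pos ha hy0
  have := Real.arccos_injOn ⟨by linarith, h1⟩ ⟨by linarith, h2⟩ hxy
  field_simp at this
  exact this.symm

lemma image_arccos_div (ha : 0 < a) {r : ℝ} (hr : a < r) :
    (fun T => Real.arccos (a / T)) '' Set.Ioo a r = Set.Ioo 0 (Real.arccos (a / r)) := by
  have hr0 : 0 < r := ha.trans hr
  have har : 0 < a / r := div_pos ha hr0
  have har1 : a / r < 1 := (div_lt_one hr0).2 hr
  ext φ
  constructor
  · rintro ⟨T, hT, rfl⟩
    have hT0 : 0 < T := ha.trans hT.1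
    have h1 : a / T < 1 := (div_lt_one hT0).2 hT.1
    refine ⟨Real.arccos_pos.2 h1, Real.arccos_lt_arccos (by linarith) ?_ h1.le⟩
    exact div_lt_div_of_pos_left ha hT0 hT.2
  · rintro ⟨h0, h1⟩
    have hπ : φ ≤ Real.pi := h1.le.trans (Real.arccos_le_pi _)
    have hc1 : Real.cos φ < 1 := by
      rw [← Real.cos_zero]
      exact Real.cos_lt_cos_of_nonneg_of_le_pi le_rfl hπ h0
    have hc2 : a / r < Real.cos φ := by
      rw [← Real.cos_arccos (by linarith) har1.le]
      exact Real.cos_lt_cos_of_nonneg_of_le_pi h0.le (Real.arccos_le_pi _) h1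
    have hc0 : 0 < Real.cos φ := har.trans hc2
    refine ⟨a / Real.cos φ, ⟨?_, ?_⟩, ?_⟩
    · rw [lt_div_iff₀ hc0]; nlinarith
    · rw [div_lt_iff₀ hc0]; rw [div_lt_iff₀ hr0] at hc2; linarith
    · simp only
      rw [div_div_cancel₀ ha.ne', Real.arccos_cos h0.le hπ]

/-- Substitution cos φ = a / T, on the open interval because the derivative is unbounded at T = a.
-/
lemma integral_arccos_div (ha : 0 < a) {r : ℝ} (hr : a < r) (g : ℝ → ℝ) :
    ∫ φ in Set.Ioo 0 (Real.arccos (a / r)), g φ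
      = ∫ T in Set.Ioo a r, a / (T * √(T ^ 2 - a ^ 2)) * g (Real.arccos (a / T)) := by
  rw [← image_arccos_div ha hr, integral_image_eq_integral_abs_deriv_smul measurableSet_Ioo
    (fun T hT => (hasDerivAt_arccos_div ha hT.1).hasDerivWithinAt) (injOn_arccos_div ha r)]
  refine setIntegral_congr_fun measurableSet_Ioo fun T hT => ?_
  have : 0 < T := ha.trans hT.1
  simp only [smul_eq_mul]
  rw [abs_of_nonneg (by positivity)]

/-- The singularity at T = a is integrable because the function is the Jacobian of a map onto a
bounded interval. -/
lemma integrableOn_arccos_deriv (ha : 0 < a) {r : ℝ} (hr : a < r) :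
    IntegrableOn (fun T => a / (T * √(T ^ 2 - a ^ 2))) (Set.Ioo a r) := by
  have h := (integrableOn_image_iff_integrableOn_abs_deriv_smul (measurableSet_Ioo (a := a) (b := r))
    (fun T hT => (hasDerivAt_arccos_div ha hT.1).hasDerivWithinAt) (injOn_arccos_div ha r)
    (fun _ => (1 : ℝ))).1 (by
      rw [image_arccos_div ha hr]
      exact integrableOn_const (by simp))
  refine h.congr_fun (fun T hT => ?_) measurableSet_Ioo
  have : 0 < T := ha.trans hT.1
  simp only [smul_eq_mul, mul_one]
  rw [abs_of_nonneg (by positivity)]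

lemma integrableOn_crossingDensity_mul (ha : 0 < a) (hb : 0 < b) {f : ℝ → ℝ} (hf : Measurable f)
    {C : ℝ} (hC : ∀ t, |f t| ≤ C) :
    IntegrableOn (fun T => crossingDensity a b T * f T) (Set.Ioo a √(a ^ 2 + b ^ 2)) := by
  have hC0 : 0 ≤ C := (abs_nonneg _).trans (hC 0)
  have h : IntegrableOn (fun T => a / (T * √(T ^ 2 - a ^ 2))
      * ((b - √(T ^ 2 - a ^ 2)) / (b + √(T ^ 2 - a ^ 2)) * f T)) (Set.Ioo a √(a ^ 2 + b ^ 2)) :=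
    (integrableOn_arccos_deriv ha (lt_sqrt_diag (a := a) hb)).mul_bdd (c := C)
    (by fun_prop) (by
      refine (ae_restrict_iff' measurableSet_Ioo).2 (Eventually.of_forall fun T hT => ?_)
      have hu := sqrt_leg_lt ha hb hT.1.le hT.2
      have hu0 := Real.sqrt_nonneg (T ^ 2 - a ^ 2)
      rw [Real.norm_eq_abs, abs_mul, abs_of_nonneg (div_nonneg (by linarith) (by linarith))]
      calc _ ≤ 1 * C := mul_le_mul ((div_le_one (by linarith)).2 (by linarith)) (hC T)
              (abs_nonneg _) zero_le_one
        _ = C := one_mul C)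
  refine h.congr_fun (fun T hT => ?_) measurableSet_Ioo
  have hT0 : 0 < T := ha.trans hT.1
  have hu : 0 < √(T ^ 2 - a ^ 2) := Real.sqrt_pos.2 (by nlinarith [hT.1])
  simp only [crossingDensity]
  field_simp

lemma integrableOn_cornerRate_mul (ha : 0 < a) (hb : 0 < b) {F : ℝ → ℝ} (hF : Continuous F) :
    IntegrableOn (fun T => cornerRate a b T * F T) (Set.Ioo a √(a ^ 2 + b ^ 2)) := by
  have : IntegrableOn (fun T => cornerRate a b T * F T) (Set.Icc a √(a ^ 2 + b ^ 2)) :=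
    ContinuousOn.integrableOn_Icc (((continuousOn_cornerRate hb).mono fun x hx =>
      ha.trans_le hx.1).mul hF.continuousOn)
  exact this.mono_set Set.Ioo_subset_Icc_self

/-- The directions of the particles that cannot fly between the walls at distance `b` are
parametrized by the length of a flight between the walls at distance `a`. -/
lemma integral_clockMean_eq (ha : 0 < a) (hb : 0 < b) {f : ℝ → ℝ} (hf : Continuous f)
    {C : ℝ} (hC : ∀ t, |f t| ≤ C) :
    ∫ φ in Set.Ioo 0 (Real.arccos (a / √(a ^ 2 + b ^ 2))),
        clockMean (a / Real.cos φ) (b / Real.sin φ) f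
      = (∫ T in Set.Ioo a √(a ^ 2 + b ^ 2), crossingDensity a b T * f T)
        + ∫ T in Set.Ioo a √(a ^ 2 + b ^ 2), cornerRate a b T * ∫ t in 0..T, f t := by
  have hF : Continuous fun T => ∫ t in (0 : ℝ)..T, f t :=
    intervalIntegral.continuous_primitive (fun _ _ => hf.intervalIntegrable _ _) 0
  rw [integral_arccos_div ha (lt_sqrt_diag hb), ← integral_add
    (integrableOn_crossingDensity_mul ha hb hf.measurable hC) (integrableOn_cornerRate_mul ha hb hF)]
  refine setIntegral_congr_fun measurableSet_Ioo fun T hT => ?_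
  have hT0 : 0 < T := ha.trans hT.1
  have hu : 0 < √(T ^ 2 - a ^ 2) := Real.sqrt_pos.2 (by nlinarith [hT.1])
  have hub := sqrt_leg_lt ha hb hT.1.le hT.2
  have h1 : a / T < 1 := (div_lt_one hT0).2 hT.1
  have h0 : 0 < a / T := div_pos ha hT0
  have e : √(1 - (a / T) ^ 2) = √(T ^ 2 - a ^ 2) / T := by
    rw [show 1 - (a / T) ^ 2 = (T ^ 2 - a ^ 2) / T ^ 2 by field_simp,
      Real.sqrt_div (by nlinarith [hT.1]), Real.sqrt_sq hT0.le]
  rw [Real.cos_arccos (by linarith) h1.le, Real.sin_arccos, e, div_div_cancel₀ ha.ne']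
  set u := √(T ^ 2 - a ^ 2)
  -- Below the diagonal the walls at distance `a` have the shorter period, which is T itself.
  have hle : T ≤ b / (u / T) := by
    rw [le_div_iff₀ (by positivity)]; field_simp; exact hub.le
  rw [clockMean, min_eq_left hle, abs_of_nonneg (sub_nonneg.2 hle), crossingDensity, cornerRate]
  change a / (T * u) * _ = a * (b - u) / (T * (b + u) * u) * f T
    + 2 * a / (b + u) * (1 / T ^ 2) * _
  generalize (∫ t in (0 : ℝ)..T, f t) = F
  have : 0 < b + u := by linarith
  -- This is α + β. Multiplied by the Jacobian a / (T u), the weight (β - α) / (α + β) becomes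
  -- `crossingDensity` and 2 / (α + β) becomes `cornerRate`.
  have : T + b / (u / T) = T * (u + b) / u := by field_simp
  rw [this]
  field_simp
  ring

/-- The part of the density, up to a factor, that is due to the walls at distance `a`. -/
noncomputable def wallDensity (a b t : ℝ) : ℝ :=
  (if a < t then crossingDensity a b t else 0)
    + ∫ T in (max a t)..(√(a ^ 2 + b ^ 2)), cornerRate a b T

lemma continuousOn_integral_cornerRate (ha : 0 < a) (hb : 0 < b) :
    ContinuousOn (fun t => ∫ T in (max a t)..(√(a ^ 2 + b ^ 2)), cornerRate a b T)
      (Set.Icc 0 √(a ^ 2 + b ^ 2)) := by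
  have h : Continuous fun t => cornerPrimitive a b (max a t)
      - 2 * a * b / √(a ^ 2 + b ^ 2) ^ 3 * Real.log b := by
    refine Continuous.sub ?_ continuous_const
    exact (continuousOn_cornerPrimitive ha hb).comp_continuous (by fun_prop)
      fun t => ha.trans_le (le_max_left _ _)
  refine h.continuousOn.congr fun t ht => ?_
  exact integral_cornerRate ha hb (le_max_left _ _) (max_le (lt_sqrt_diag hb).le ht.2)

/-- An exchange of integrations, carried out by parts on [a, r]: the boundary term at r vanishes,
and the one at a cancels the part over [0, a], where the inner integral is constant. -/
lemma integral_integral_cornerRate_mul (ha : 0 < a) (hb : 0 < b) {f : ℝ → ℝ} (hf : Continuous f) :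
    ∫ t in 0..√(a ^ 2 + b ^ 2), (∫ T in (max a t)..(√(a ^ 2 + b ^ 2)), cornerRate a b T) * f t
      = ∫ T in a..√(a ^ 2 + b ^ 2), cornerRate a b T * ∫ t in 0..T, f t := by
  have hr := sqrt_diag_pos (b := b) ha
  have har := lt_sqrt_diag (a := a) hb
  have hcont := (continuousOn_integral_cornerRate ha hb).mul hf.continuousOn
  set r := √(a ^ 2 + b ^ 2) with hrdef
  have hF : ∀ T, HasDerivAt (fun T => ∫ t in (0 : ℝ)..T, f t) (f T) T := fun T =>
    intervalIntegral.integral_hasDerivAt_right (hf.intervalIntegrable _ _)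
      (hf.stronglyMeasurableAtFilter _ _) hf.continuousAt
  have i1 : IntervalIntegrable (fun t => (∫ T in (max a t)..r, cornerRate a b T) * f t)
      volume 0 a :=
    (hcont.mono (by rw [Set.uIcc_of_le ha.le]; exact Set.Icc_subset_Icc_right har.le))
      |>.intervalIntegrable
  have i2 : IntervalIntegrable (fun t => (∫ T in (max a t)..r, cornerRate a b T) * f t)
      volume a r :=
    (hcont.mono (by rw [Set.uIcc_of_le har.le]; exact Set.Icc_subset_Icc_left ha.le))
      |>.intervalIntegrable
  rw [← intervalIntegral.integral_add_adjacent_intervals i1 i2]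
  have e1 : ∫ t in 0..a, (∫ T in (max a t)..r, cornerRate a b T) * f t
      = (∫ T in a..r, cornerRate a b T) * ∫ t in 0..a, f t := by
    rw [← intervalIntegral.integral_const_mul]
    refine intervalIntegral.integral_congr fun t ht => ?_
    rw [Set.uIcc_of_le ha.le] at ht
    rw [max_eq_left ht.2]
  have e2 : ∫ t in a..r, (∫ T in (max a t)..r, cornerRate a b T) * f t
      = ∫ t in a..r, (cornerPrimitive a b t - 2 * a * b / r ^ 3 * Real.log b) * f t := by
    refine intervalIntegral.integral_congr fun t ht => ?_
    rw [Set.uIcc_of_le har.le] at ht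
    rw [max_eq_right ht.1, integral_cornerRate ha hb ht.1 ht.2]
  have e3 := intervalIntegral.integral_mul_deriv_eq_deriv_mul_of_hasDerivAt
    (a := a) (b := r) (u := fun t => cornerPrimitive a b t - 2 * a * b / r ^ 3 * Real.log b)
    (v := fun T => ∫ t in (0 : ℝ)..T, f t) (u' := fun t => -cornerRate a b t) (v' := f)
    (((continuousOn_cornerPrimitive ha hb).mono fun x hx => by
      rw [Set.uIcc_of_le har.le] at hx; exact ha.trans_le hx.1).sub continuousOn_const)
    (fun T _ => (hF T).continuousAt.continuousWithinAt)
    (fun T hT => by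
      rw [min_eq_left har.le] at hT
      exact (hasDerivAt_cornerPrimitive ha hb hT.1).sub_const _)
    (fun T _ => hF T) (intervalIntegrable_cornerRate hb ha hr).neg (hf.intervalIntegrable _ _)
  have e4 : cornerPrimitive a b r - 2 * a * b / r ^ 3 * Real.log b = 0 := by
    rw [← integral_cornerRate ha hb har.le le_rfl, ← hrdef, intervalIntegral.integral_same]
  have e5 := integral_cornerRate ha hb le_rfl har.le
  rw [← hrdef] at e5
  rw [e1, e2, e3, e4, ← e5]
  simp only [neg_mul, intervalIntegral.integral_neg]
  ring

lemma integrableOn_wallDensity_mul (ha : 0 < a) (hb : 0 < b) {f : ℝ → ℝ} (hf : Continuous f)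
    {C : ℝ} (hC : ∀ t, |f t| ≤ C) :
    IntegrableOn (fun t => (if a < t then crossingDensity a b t else 0) * f t)
        (Set.Ioo 0 √(a ^ 2 + b ^ 2)) ∧
      IntegrableOn (fun t => (∫ T in (max a t)..(√(a ^ 2 + b ^ 2)), cornerRate a b T) * f t)
        (Set.Ioo 0 √(a ^ 2 + b ^ 2)) := by
  constructor
  · have h := (integrableOn_crossingDensity_mul ha hb hf.measurable hC).integrable_indicator
      measurableSet_Ioo
    refine h.integrableOn.congr_fun (fun t ht => ?_) measurableSet_Ioo
    by_cases hat : a < t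
    · rw [Set.indicator_of_mem (show t ∈ Set.Ioo a _ from ⟨hat, ht.2⟩), if_pos hat]
    · rw [Set.indicator_of_notMem (fun h => hat h.1), if_neg hat, zero_mul]
  · exact (((continuousOn_integral_cornerRate ha hb).mul hf.continuousOn).integrableOn_Icc).mono_set
      Set.Ioo_subset_Icc_self

theorem integral_clockMean_eq_wallDensity (ha : 0 < a) (hb : 0 < b) {f : ℝ → ℝ}
    (hf : Continuous f) {C : ℝ} (hC : ∀ t, |f t| ≤ C) :
    IntegrableOn (fun t => wallDensity a b t * f t) (Set.Ioo 0 √(a ^ 2 + b ^ 2)) ∧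
    ∫ φ in Set.Ioo 0 (Real.arccos (a / √(a ^ 2 + b ^ 2))),
        clockMean (a / Real.cos φ) (b / Real.sin φ) f
      = ∫ t in Set.Ioo 0 √(a ^ 2 + b ^ 2), wallDensity a b t * f t := by
  obtain ⟨i1, i2⟩ := integrableOn_wallDensity_mul ha hb hf hC
  have hr := sqrt_diag_pos (b := b) ha
  have har := lt_sqrt_diag (a := a) hb
  have h := integral_integral_cornerRate_mul ha hb hf
  rw [intervalIntegral.integral_of_le hr.le, intervalIntegral.integral_of_le har.le,
    integral_Ioc_eq_integral_Ioo, integral_Ioc_eq_integral_Ioo] at h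
  have e : ∫ t in Set.Ioo 0 √(a ^ 2 + b ^ 2), (if a < t then crossingDensity a b t else 0) * f t
      = ∫ t in Set.Ioo a √(a ^ 2 + b ^ 2), crossingDensity a b t * f t := by
    rw [← integral_indicator measurableSet_Ioo, ← integral_indicator measurableSet_Ioo]
    congr 1
    ext t
    by_cases hat : a < t
    · by_cases htr : t < √(a ^ 2 + b ^ 2)
      · rw [Set.indicator_of_mem (show t ∈ Set.Ioo a _ from ⟨hat, htr⟩),
          Set.indicator_of_mem (show t ∈ Set.Ioo 0 _ from ⟨ha.trans hat, htr⟩), if_pos hat]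
      · rw [Set.indicator_of_notMem (fun h => htr h.2), Set.indicator_of_notMem (fun h => htr h.2)]
    · rw [Set.indicator_of_notMem (s := Set.Ioo a _) (fun h => hat h.1)]
      simp only [Set.indicator_apply, if_neg hat, zero_mul, ite_self]
  constructor
  · simp only [wallDensity, add_mul]
    exact i1.add i2
  · rw [integral_clockMean_eq ha hb hf hC, ← h, ← e, ← integral_add i1 i2]
    simp only [wallDensity, add_mul]

end crossing

/-! ### Uniformly distributed directions -/

section directions

lemma measurable_direction :
    Measurable (fun φ : ℝ => (!₂[Real.cos φ, Real.sin φ] : Plane)) := by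
  refine (WithLp.measurable_toLp 2 (Fin 2 → ℝ)).comp (measurable_pi_lambda _ fun i => ?_)
  fin_cases i
  · exact Real.measurable_cos
  · exact Real.measurable_sin

instance : IsProbabilityMeasure uniformDirection := by
  constructor
  have h2 : 0 < 2 * Real.pi := by positivity
  rw [uniformDirection, Measure.smul_apply, Measure.map_apply measurable_direction .univ,
    Set.preimage_univ, Measure.restrict_apply_univ, Real.volume_Ioc, sub_zero, smul_eq_mul]
  exact ENNReal.inv_mul_cancel (by simpa using Real.pi_pos) ENNReal.ofReal_ne_top

/-- The expression is a nonzero multiple of a shifted cosine. -/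
lemma countable_mul_cos_add_mul_sin_eq_zero {A B : ℝ} (h : A ≠ 0 ∨ B ≠ 0) :
    {φ : ℝ | A * Real.cos φ + B * Real.sin φ = 0}.Countable := by
  set z : ℂ := ⟨A, B⟩ with hz
  have hz0 : z ≠ 0 := by
    intro h0
    rw [Complex.ext_iff] at h0
    rcases h with h | h
    · exact h h0.1
    · exact h h0.2
  refine (Set.countable_range fun k : ℤ => (2 * k + 1) * Real.pi / 2 + z.arg).mono ?_
  intro φ hφ
  have e : ‖z‖ * Real.cos (φ - z.arg) = 0 := by
    have h1 : ‖z‖ * Real.cos z.arg = A := Complex.norm_mul_cos_arg z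
    have h2 : ‖z‖ * Real.sin z.arg = B := Complex.norm_mul_sin_arg z
    have h3 : A * Real.cos φ + B * Real.sin φ = 0 := hφ
    rw [Real.cos_sub, ← h3, ← h1, ← h2]
    ring
  obtain ⟨k, hk⟩ := Real.cos_eq_zero_iff.1 ((mul_eq_zero.1 e).resolve_left (norm_ne_zero_iff.2 hz0))
  exact ⟨k, by simp only; rw [← hk]; ring⟩

/-- The unit vectors along which the times between walls of either direction are incommensurable. -/
def IsIrrationalDirection (a b : ℝ) (v : Plane) : Prop :=
  v 0 ≠ 0 ∧ v 1 ≠ 0 ∧ ‖v‖ = 1 ∧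
    ∀ n : ℤ, n ≠ 0 → ∀ m : ℤ, n * (b / |v 1|) ≠ m * (a / |v 0|)

lemma measurableSet_isIrrationalDirection (a b : ℝ) :
    MeasurableSet {v | IsIrrationalDirection a b v} := by
  have m0 : Measurable fun v : Plane => v 0 := by fun_prop
  have m1 : Measurable fun v : Plane => v 1 := by fun_prop
  have hirr : MeasurableSet {v : Plane | ∀ n : ℤ, n ≠ 0 → ∀ m : ℤ,
      n * (b / |v 1|) ≠ m * (a / |v 0|)} := by
    simp only [Set.ofPred_forall]
    refine MeasurableSet.iInter fun n => MeasurableSet.iInter fun _ => MeasurableSet.iInter fun m =>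
      (measurableSet_eq_fun ?_ ?_).compl
    · exact ((m1.abs).const_div b).const_mul _
    · exact ((m0.abs).const_div a).const_mul _
  exact (measurableSet_eq_fun m0 measurable_const).compl.inter
    ((measurableSet_eq_fun m1 measurable_const).compl.inter
      ((measurableSet_eq_fun measurable_norm measurable_const).inter hirr))

lemma ae_isIrrationalDirection {a b : ℝ} (ha : 0 < a) (hb : 0 < b) :
    ∀ᵐ v ∂uniformDirection, IsIrrationalDirection a b v := by
  -- Up to signs, commensurable periods are an integer relation between b cos φ and a sin φ. The
  -- pairs (1, 0) and (0, 1) exclude directions parallel to a wall.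
  have key : ∀ᵐ φ : ℝ, ∀ n m : ℤ, n ≠ 0 ∨ m ≠ 0 →
      n * b * Real.cos φ + m * a * Real.sin φ ≠ 0 := by
    rw [ae_all_iff]; intro n
    rw [ae_all_iff]; intro m
    by_cases h : n ≠ 0 ∨ m ≠ 0
    · have hc := countable_mul_cos_add_mul_sin_eq_zero (A := n * b) (B := m * a) (by
        rcases h with h | h
        · left; exact mul_ne_zero (by exact_mod_cast h) hb.ne'
        · right; exact mul_ne_zero (by exact_mod_cast h) ha.ne')
      filter_upwards [hc.ae_notMem volume] with φ hφ _ using hφ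
    · exact Eventually.of_forall fun _ h' => absurd h' h
  refine Measure.ae_smul_measure ?_ _
  rw [ae_map_iff measurable_direction.aemeasurable (measurableSet_isIrrationalDirection a b)]
  refine ae_restrict_of_ae ?_
  filter_upwards [key] with φ hφ
  have hc : Real.cos φ ≠ 0 := fun h => hφ 1 0 (by simp) (by simp [h])
  have hs : Real.sin φ ≠ 0 := fun h => hφ 0 1 (by simp) (by simp [h])
  refine ⟨hc, hs, ?_, ?_⟩
  · have := norm_plane_sq (!₂[Real.cos φ, Real.sin φ] : Plane)
    simp only [sq_abs] at this
    change _ = Real.cos φ ^ 2 + Real.sin φ ^ 2 at this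
    rw [Real.cos_sq_add_sin_sq] at this
    exact (pow_eq_one_iff_of_nonneg (norm_nonneg _) two_ne_zero).1 this
  · intro n hn m
    change (n : ℝ) * (b / |Real.sin φ|) ≠ m * (a / |Real.cos φ|)
    intro e
    have hc' := abs_pos.2 hc
    have hs' := abs_pos.2 hs
    field_simp at e
    rcases abs_choice (Real.cos φ) with h1 | h1 <;> rcases abs_choice (Real.sin φ) with h2 | h2 <;>
      rw [h1, h2] at e
    · exact hφ n (-m) (Or.inl hn) (by push_cast; linarith)
    · exact hφ n m (Or.inl hn) (by linarith)
    · exact hφ n m (Or.inl hn) (by linarith)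
    · exact hφ n (-m) (Or.inl hn) (by push_cast; linarith)

end directions

/-! ### The mean over uniform directions as an integral against the density -/

section average

variable {a b : ℝ} {f : ℝ → ℝ} {C : ℝ}

lemma measurable_clockMean (hf : Continuous f) :
    Measurable fun p : ℝ × ℝ => clockMean p.1 p.2 f := by
  have hF : Measurable fun T => ∫ t in (0 : ℝ)..T, f t :=
    (intervalIntegral.continuous_primitive (fun _ _ => hf.intervalIntegrable _ _) 0).measurable
  have hm : Measurable fun p : ℝ × ℝ => min p.1 p.2 := measurable_fst.min measurable_snd
  have h1 := hF.comp hm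
  have h2 := hf.measurable.comp hm
  simp only [clockMean]
  exact ((h1.const_mul 2).add ((measurable_snd.sub measurable_fst).abs.mul h2)).div
    (measurable_fst.add measurable_snd)

/-- The weights are those of an average, since α + β = 2 min α β + |β - α|. -/
lemma abs_clockMean_le {α β : ℝ} (hα : 0 ≤ α) (hβ : 0 ≤ β) (hC : ∀ t, |f t| ≤ C) :
    |clockMean α β f| ≤ C := by
  have hC0 : 0 ≤ C := (abs_nonneg _).trans (hC 0)
  have hm : 0 ≤ min α β := le_min hα hβ
  have h1 : |∫ t in (0 : ℝ)..(min α β), f t| ≤ C * min α β := by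
    have := intervalIntegral.norm_integral_le_of_norm_le_const (a := 0) (b := min α β) (f := f)
      (C := C) fun t _ => hC t
    rwa [sub_zero, abs_of_nonneg hm] at this
  rw [clockMean, abs_div, abs_of_nonneg (by linarith : 0 ≤ α + β)]
  refine div_le_of_le_mul₀ (by linarith) hC0 ?_
  have h2 : α + β = 2 * min α β + |β - α| := by
    rcases le_total α β with h | h
    · rw [min_eq_left h, abs_of_nonneg (by linarith)]; ring
    · rw [min_eq_right h, abs_of_nonpos (by linarith)]; ring
  calc _ ≤ |2 * ∫ t in (0 : ℝ)..(min α β), f t| + |(|β - α|) * f (min α β)| := abs_add_le _ _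
    _ = 2 * |∫ t in (0 : ℝ)..(min α β), f t| + |β - α| * |f (min α β)| := by
      rw [abs_mul, abs_mul, abs_abs, abs_two]
    _ ≤ 2 * (C * min α β) + |β - α| * C := by gcongr; exact hC _
    _ = C * (α + β) := by rw [h2]; ring

lemma clockMean_one {α β : ℝ} (hα : 0 < α) (hβ : 0 < β) : clockMean α β (fun _ => 1) = 1 := by
  rw [clockMean, intervalIntegral.integral_const, sub_zero, smul_eq_mul, mul_one, mul_one,
    div_eq_one_iff_eq (by positivity)]
  rcases le_total α β with h | h
  · rw [min_eq_left h, abs_of_nonneg (by linarith)]; ring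
  · rw [min_eq_right h, abs_of_nonpos (by linarith)]; ring

lemma integral_uniformDirection {H : Plane → ℝ} (hH : Measurable H) :
    ∫ v, H v ∂uniformDirection
      = (2 * Real.pi)⁻¹ * ∫ φ in 0..(2 * Real.pi), H !₂[Real.cos φ, Real.sin φ] := by
  rw [uniformDirection, integral_smul_measure, integral_map measurable_direction.aemeasurable
    hH.aestronglyMeasurable, intervalIntegral.integral_of_le (by positivity), ENNReal.toReal_inv,
    ENNReal.toReal_ofReal (by positivity), smul_eq_mul]

lemma integral_circle_eq_quadrant {q : ℝ → ℝ} (hq : ∀ x y, IntervalIntegrable q volume x y)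
    (h1 : ∀ x, q (x + Real.pi) = q x) (h2 : ∀ x, q (Real.pi - x) = q x) :
    ∫ φ in 0..(2 * Real.pi), q φ = 4 * ∫ φ in 0..(Real.pi / 2), q φ := by
  have e1 : ∫ φ in Real.pi..(2 * Real.pi), q φ = ∫ φ in 0..Real.pi, q φ := by
    have := intervalIntegral.integral_comp_add_right (a := 0) (b := Real.pi) q Real.pi
    simp only [h1] at this
    rw [this]; congr 1 <;> ring
  have e2 : ∫ φ in (Real.pi / 2)..Real.pi, q φ = ∫ φ in 0..(Real.pi / 2), q φ := by
    have := intervalIntegral.integral_comp_sub_left (a := 0) (b := Real.pi / 2) q Real.pi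
    simp only [h2] at this
    rw [this]; congr 1 <;> ring
  rw [← intervalIntegral.integral_add_adjacent_intervals (hq 0 Real.pi) (hq _ _), e1,
    ← intervalIntegral.integral_add_adjacent_intervals (hq 0 (Real.pi / 2)) (hq _ _), e2]
  ring

lemma pi_div_two_sub_arccos_leg (ha : 0 < a) (hb : 0 < b) :
    Real.pi / 2 - Real.arccos (b / √(a ^ 2 + b ^ 2)) = Real.arccos (a / √(a ^ 2 + b ^ 2)) := by
  have hr := sqrt_diag_pos (b := b) ha
  have hr2 := sq_sqrt_diag (a := a) (b := b)
  rw [← Real.arcsin_eq_pi_div_two_sub_arccos, Real.arcsin_eq_arccos (by positivity)]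
  congr 1
  rw [show 1 - (b / √(a ^ 2 + b ^ 2)) ^ 2 = (a / √(a ^ 2 + b ^ 2)) ^ 2 by
    field_simp; linarith, Real.sqrt_sq (by positivity)]

/-- By symmetry one quadrant suffices, whence 4 / (2π) = 2 / π. It is cut at the diagonal of the
box, and φ ↦ π/2 - φ carries the upper part to the lower part with a and b interchanged. -/
theorem integral_clockMean_uniformDirection (ha : 0 < a) (hb : 0 < b) (hf : Continuous f)
    (hC : ∀ t, |f t| ≤ C) :
    ∫ v, clockMean (a / |v 0|) (b / |v 1|) f ∂uniformDirection
      = 2 / Real.pi * ((∫ t in Set.Ioo 0 √(a ^ 2 + b ^ 2), wallDensity a b t * f t)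
        + ∫ t in Set.Ioo 0 √(a ^ 2 + b ^ 2), wallDensity b a t * f t) := by
  have hmeas := measurable_clockMean hf
  rw [integral_uniformDirection (H := fun v => clockMean (a / |v 0|) (b / |v 1|) f)
    (hmeas.comp (f := fun v : Plane => (a / |v 0|, b / |v 1|)) (by fun_prop))]
  change _ * ∫ φ in 0..(2 * Real.pi), clockMean (a / |Real.cos φ|) (b / |Real.sin φ|) f = _
  set q : ℝ → ℝ := fun φ => clockMean (a / |Real.cos φ|) (b / |Real.sin φ|) f with hqdef
  have hqm : Measurable q :=
    hmeas.comp (f := fun φ : ℝ => (a / |Real.cos φ|, b / |Real.sin φ|)) (by fun_prop)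
  have hq : ∀ x y, IntervalIntegrable q volume x y := fun x y =>
    (intervalIntegrable_const (c := C)).mono_fun' hqm.aestronglyMeasurable
      (Eventually.of_forall fun φ => abs_clockMean_le (by positivity) (by positivity) hC)
  have hr := sqrt_diag_pos (b := b) ha
  have hA := pi_div_two_sub_arccos_leg ha hb
  set A := Real.arccos (a / √(a ^ 2 + b ^ 2)) with hAdef
  set B := Real.arccos (b / √(a ^ 2 + b ^ 2)) with hBdef
  have hA0 : 0 ≤ A := Real.arccos_nonneg _
  have hB0 : 0 ≤ B := Real.arccos_nonneg _
  have e1 : ∫ φ in 0..A, q φ = ∫ t in Set.Ioo 0 √(a ^ 2 + b ^ 2), wallDensity a b t * f t := by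
    rw [← (integral_clockMean_eq_wallDensity ha hb hf hC).2,
      intervalIntegral.integral_of_le hA0, integral_Ioc_eq_integral_Ioo]
    refine setIntegral_congr_fun measurableSet_Ioo fun φ hφ => ?_
    have hc : 0 < Real.cos φ :=
      Real.cos_pos_of_mem_Ioo ⟨by linarith [hφ.1, Real.pi_pos], by linarith [hφ.2]⟩
    have hs : 0 < Real.sin φ :=
      Real.sin_pos_of_pos_of_lt_pi hφ.1 (by linarith [hφ.2, Real.pi_pos])
    simp only [hqdef, abs_of_pos hc, abs_of_pos hs]
  have e2 : ∫ φ in A..(Real.pi / 2), q φ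
      = ∫ t in Set.Ioo 0 √(a ^ 2 + b ^ 2), wallDensity b a t * f t := by
    have hcm := add_comm (a ^ 2) (b ^ 2)
    have := (integral_clockMean_eq_wallDensity hb ha hf hC).2
    rw [← hcm] at this
    rw [← this, ← hA]
    have hsub := intervalIntegral.integral_comp_sub_left (a := 0) (b := B) q (Real.pi / 2)
    rw [sub_zero] at hsub
    rw [← hsub, intervalIntegral.integral_of_le hB0, integral_Ioc_eq_integral_Ioo]
    refine setIntegral_congr_fun measurableSet_Ioo fun φ hφ => ?_
    have hc : 0 < Real.cos φ :=
      Real.cos_pos_of_mem_Ioo ⟨by linarith [hφ.1, Real.pi_pos], by linarith [hφ.2]⟩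
    have hs : 0 < Real.sin φ :=
      Real.sin_pos_of_pos_of_lt_pi hφ.1 (by linarith [hφ.2, Real.pi_pos])
    simp only [hqdef, Real.cos_pi_div_two_sub, Real.sin_pi_div_two_sub, abs_of_pos hc,
      abs_of_pos hs]
    exact clockMean_swap _ _ _
  rw [integral_circle_eq_quadrant hq (fun x => by simp [hqdef, Real.cos_add_pi, Real.sin_add_pi])
      (fun x => by simp [hqdef, Real.cos_pi_sub, Real.sin_pi_sub]),
    ← intervalIntegral.integral_add_adjacent_intervals (hq 0 A) (hq _ _), e1, e2]
  field_simp
  norm_num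

lemma measurable_absorptionPDF (a b : ℝ) : Measurable (absorptionPDF a b) := by
  have hart : Measurable Real.artanh := by unfold Real.artanh; fun_prop
  unfold absorptionPDF
  refine Measurable.ite measurableSet_Ioo (by fun_prop) (Measurable.ite measurableSet_Ioo ?_
    (Measurable.ite measurableSet_Ioo ?_ measurable_const))
  · fun_prop
  · fun_prop

lemma absorptionPDF_mul_ae_eq (ha : 0 < a) (hab : a ≤ b) (f : ℝ → ℝ) :
    (fun t => absorptionPDF a b t * f t) =ᵐ[volume]
      (Set.Ioo 0 √(a ^ 2 + b ^ 2)).indicator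
        (fun t => 2 / Real.pi * (wallDensity a b t * f t + wallDensity b a t * f t)) := by
  have h1 : ∀ᵐ t : ℝ, t ≠ a := by simp [ae_iff]
  have h2 : ∀ᵐ t : ℝ, t ≠ b := by simp [ae_iff]
  filter_upwards [h1, h2] with t ha' hb'
  by_cases ht : t ∈ Set.Ioo 0 √(a ^ 2 + b ^ 2)
  · rw [Set.indicator_of_mem ht, absorptionPDF_eq_add ha hab ht.1 ht.2 ha' hb', singularPart_eq,
      smoothPart_eq, wallDensity, wallDensity]
    ring
  · rw [Set.indicator_of_notMem ht, absorptionPDF_eq_zero ha hab, zero_mul]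
    by_contra! h
    exact ht ⟨h.1, h.2.1⟩

theorem integral_absorptionPDF_mul (ha : 0 < a) (hab : a ≤ b) (hf : Continuous f)
    (hC : ∀ t, |f t| ≤ C) :
    Integrable (fun t => absorptionPDF a b t * f t) ∧
    ∫ t, absorptionPDF a b t * f t
      = ∫ v, clockMean (a / |v 0|) (b / |v 1|) f ∂uniformDirection := by
  have hb : 0 < b := ha.trans_le hab
  have i1 := (integral_clockMean_eq_wallDensity ha hb hf hC).1
  have i2 := (integral_clockMean_eq_wallDensity hb ha hf hC).1
  rw [add_comm (b ^ 2)] at i2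
  have hae := absorptionPDF_mul_ae_eq ha hab f
  constructor
  · refine Integrable.congr ?_ hae.symm
    rw [integrable_indicator_iff measurableSet_Ioo]
    exact (Integrable.add i1 i2).const_mul _
  · rw [integral_congr_ae hae, integral_indicator measurableSet_Ioo, integral_const_mul,
      integral_add i1 i2, integral_clockMean_uniformDirection ha hb hf hC]

/-- The total mass is the case f = 1, in which every mean over an orbit is 1; the closed form is not
integrated. -/
theorem integral_absorptionPDF (ha : 0 < a) (hab : a ≤ b) :
    Integrable (absorptionPDF a b) ∧ ∫ t, absorptionPDF a b t = 1 := by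
  have hb : 0 < b := ha.trans_le hab
  have h := integral_absorptionPDF_mul ha hab (f := fun _ => (1 : ℝ)) continuous_const (C := 1)
    (by simp)
  simp only [mul_one] at h
  refine ⟨h.1, h.2.trans ?_⟩
  have : (fun v : Plane => clockMean (a / |v 0|) (b / |v 1|) fun _ => 1)
      =ᵐ[uniformDirection] fun _ => 1 := by
    filter_upwards [ae_isIrrationalDirection ha hb] with v hv
    exact clockMean_one (div_pos ha (abs_pos.2 hv.1)) (div_pos hb (abs_pos.2 hv.2.1))
  rw [integral_congr_ae this]
  simp

/-- The law with density `absorptionPDF a b`. -/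
theorem isProbabilityMeasure_withDensity_absorptionPDF (ha : 0 < a) (hab : a ≤ b) :
    IsProbabilityMeasure
      (volume.withDensity fun t => ENNReal.ofReal (absorptionPDF a b t)) := by
  obtain ⟨h1, h2⟩ := integral_absorptionPDF ha hab
  constructor
  rw [withDensity_apply _ .univ, Measure.restrict_univ, ← ofReal_integral_eq_lintegral_ofReal h1
    (Eventually.of_forall (absorptionPDF_nonneg ha hab)), h2, ENNReal.ofReal_one]

theorem integral_withDensity_absorptionPDF (ha : 0 < a) (hab : a ≤ b) (hf : Continuous f)
    (hC : ∀ t, |f t| ≤ C) :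
    ∫ t, f t ∂(volume.withDensity fun t => ENNReal.ofReal (absorptionPDF a b t))
      = ∫ v, clockMean (a / |v 0|) (b / |v 1|) f ∂uniformDirection := by
  rw [integral_withDensity_eq_integral_toReal_smul
    (measurable_absorptionPDF a b).ennreal_ofReal (by simp),
    ← (integral_absorptionPDF_mul ha hab hf hC).2]
  simp only [ENNReal.toReal_ofReal (absorptionPDF_nonneg ha hab _), smul_eq_mul]

end average

/-! ### Random selection from a finite family and the law of large numbers -/

section selection

variable {Ω ι : Type*} [MeasurableSpace Ω] {Q : Measure Ω}
  [Fintype ι] [Nonempty ι] [MeasurableSpace ι] [MeasurableSingletonClass ι]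

lemma integral_uniformOfFintype (g : ι → ℝ) :
    ∫ i, g i ∂(PMF.uniformOfFintype ι).toMeasure = (Fintype.card ι : ℝ)⁻¹ * ∑ i, g i := by
  rw [PMF.integral_eq_sum, Finset.mul_sum]
  simp [PMF.uniformOfFintype_apply]

lemma aemeasurable_selection {Z : ι → Ω → ℝ} (hZ : ∀ i, AEMeasurable (Z i) Q) :
    AEMeasurable (fun x : Ω × ι => Z x.2 x.1) (Q.prod (PMF.uniformOfFintype ι).toMeasure) := by
  refine ⟨fun x => (hZ x.2).mk _ x.1,
    measurable_from_prod_countable_left fun i => (hZ i).measurable_mk, ?_⟩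
  have h : ∀ᵐ ω ∂Q, ∀ i, Z i ω = (hZ i).mk _ ω := ae_all_iff.2 fun i => (hZ i).ae_eq_mk
  filter_upwards [Measure.quasiMeasurePreserving_fst.ae h] with x hx using hx x.2

lemma integral_selection [IsProbabilityMeasure Q] {Z : ι → Ω → ℝ} (hZ : ∀ i, AEMeasurable (Z i) Q) {f : ℝ → ℝ}
    (hf : Measurable f) {C : ℝ} (hC : ∀ t, |f t| ≤ C) :
    ∫ x, f (Z x.2 x.1) ∂(Q.prod (PMF.uniformOfFintype ι).toMeasure)
      = (Fintype.card ι : ℝ)⁻¹ * ∑ i, ∫ ω, f (Z i ω) ∂Q := by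
  have hint : Integrable (fun x : Ω × ι => f (Z x.2 x.1))
      (Q.prod (PMF.uniformOfFintype ι).toMeasure) :=
    Integrable.of_bound (hf.comp_aemeasurable (aemeasurable_selection hZ)).aestronglyMeasurable C
      (Eventually.of_forall fun x => hC _)
  rw [integral_prod_symm _ hint, integral_uniformOfFintype]

end selection

section largeNumbers

variable {Ω E : Type*} [MeasurableSpace Ω] [MeasurableSpace E] {P : Measure Ω}
  {ρ : Measure E} {S : ℕ → Ω → E}

lemma ae_forall_of_law (hS : ∀ i, Measurable (S i)) (hlaw : ∀ i, P.map (S i) = ρ)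
    {p : E → Prop} (hp : ∀ᵐ s ∂ρ, p s) : ∀ᵐ ω ∂P, ∀ i, p (S i ω) := by
  refine ae_all_iff.2 fun i => ?_
  rw [← hlaw i] at hp
  exact ae_of_ae_map (hS i).aemeasurable hp

/-- The strong law of large numbers for a bounded observable of an i.i.d. sequence. -/
lemma strong_law_of_bounded [IsProbabilityMeasure P] (hS : ∀ i, Measurable (S i)) (hindep : iIndepFun S P)
    (hlaw : ∀ i, P.map (S i) = ρ) {h : E → ℝ} (hh : AEMeasurable h ρ) {C : ℝ}
    (hC : ∀ s, |h s| ≤ C) :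
    ∀ᵐ ω ∂P, Tendsto (fun n : ℕ => (n : ℝ)⁻¹ * ∑ i ∈ Finset.range n, h (S i ω)) atTop
      (𝓝 (∫ s, h s ∂ρ)) := by
  -- Independence is passed on by measurable maps, so `h` is replaced by a measurable version, which
  -- almost surely agrees with it along the whole sequence.
  obtain ⟨g, hgm, hge⟩ := id hh
  have hS' : ∀ i, AEMeasurable h (P.map (S i)) := fun i => by rwa [hlaw i]
  have hmeas : ∀ i, AEMeasurable (fun ω => h (S i ω)) P := fun i =>
    (hS' i).comp_measurable (hS i)
  have hind : Pairwise (Function.onFun (fun X Y => IndepFun X Y P) fun i => g ∘ S i) :=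
    fun i j hij => (hindep.comp (fun _ => g) fun _ => hgm).indepFun hij
  have hid : ∀ i, IdentDistrib (g ∘ S i) (g ∘ S 0) P P := fun i =>
    (IdentDistrib.mk (hS i).aemeasurable (hS 0).aemeasurable (by rw [hlaw, hlaw])).comp hgm
  have hae := ae_forall_of_law hS hlaw hge
  have hint : Integrable (g ∘ S 0) P := by
    refine (Integrable.of_bound (hmeas 0).aestronglyMeasurable C
      (Eventually.of_forall fun ω => hC _)).congr ?_
    filter_upwards [hae] with ω hω using hω 0
  have hmean : ∫ ω, (g ∘ S 0) ω ∂P = ∫ s, h s ∂ρ := by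
    rw [integral_congr_ae hge, ← hlaw 0, integral_map (hS 0).aemeasurable
      hgm.aestronglyMeasurable]
    rfl
  filter_upwards [strong_law_ae_real _ hint hind hid, hae] with ω hω hω'
  rw [hmean] at hω
  refine hω.congr fun n => ?_
  rw [div_eq_inv_mul]
  congr 1
  exact Finset.sum_congr rfl fun i _ => (hω' i).symm

end largeNumbers

/-- Probability measures on `ℝ` converge weakly if they converge on the intervals with rational
ends. -/
lemma tendsto_probabilityMeasure_of_rat {ι : Type*} {l : Filter ι} [l.IsCountablyGenerated]
    {κ : ι → ProbabilityMeasure ℝ} {ν : ProbabilityMeasure ℝ}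
    (h : ∀ p q : ℚ, Tendsto (fun i => (κ i : Measure ℝ).real (Set.Ioo (p : ℝ) q)) l
      (𝓝 ((ν : Measure ℝ).real (Set.Ioo (p : ℝ) q)))) : Tendsto κ l (𝓝 ν) := by
  -- The rational intervals form a π-system that contains arbitrarily small neighbourhoods of every
  -- point.
  refine IsPiSystem.tendsto_probabilityMeasure_of_tendsto_of_mem
    (isPiSystem_Ioo ((↑) : ℚ → ℝ) ((↑) : ℚ → ℝ)) ?_ ?_ ?_
  · rintro _ ⟨p, q, -, rfl⟩
    exact measurableSet_Ioo
  · intro u hu x hx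
    obtain ⟨ε, hε, hsub⟩ := Metric.isOpen_iff.1 hu x hx
    obtain ⟨p, hp1, hp2⟩ := exists_rat_btwn (show x - ε < x by linarith)
    obtain ⟨q, hq1, hq2⟩ := exists_rat_btwn (show x < x + ε by linarith)
    refine ⟨_, ⟨p, q, hp2.trans hq1, rfl⟩, Ioo_mem_nhds hp2 hq1, fun y hy => hsub ?_⟩
    rw [Real.ball_eq_Ioo]
    exact ⟨hp1.trans hy.1, hy.2.trans hq2⟩
  · rintro _ ⟨p, q, -, rfl⟩
    rw [← NNReal.tendsto_coe]
    exact h p q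

/-! ### The bounce lengths of random particles -/

section particles

variable {a b : ℝ} {μ : Measure Plane}

lemma ae_isIrrational_state (ha : 0 < a) (hb : 0 < b) (hμ : ∀ᵐ x ∂μ, x ∈ box a b) :
    ∀ᵐ s ∂μ.prod uniformDirection, s.1 ∈ box a b ∧ IsIrrationalDirection a b s.2 := by
  filter_upwards [Measure.quasiMeasurePreserving_fst.ae hμ,
    Measure.quasiMeasurePreserving_snd.ae (ae_isIrrationalDirection ha hb)] with s h1 h2
  exact ⟨h1, h2⟩

lemma aemeasurable_bounceLength_prod (ha : 0 < a) (hb : 0 < b) (hμ : ∀ᵐ x ∂μ, x ∈ box a b)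
    (k : ℕ) : AEMeasurable (fun s => bounceLength a b s k) (μ.prod uniformDirection) := by
  refine aemeasurable_bounceLength ?_ k
  filter_upwards [ae_isIrrational_state ha hb hμ] with s hs
  exact ⟨hs.1, hs.2.1, hs.2.2.1⟩

/-- The mean over the first `N` bounce lengths of a random particle converges. -/
theorem tendsto_integral_bounceLength [IsProbabilityMeasure μ] (ha : 0 < a) (hb : 0 < b) (hμ : ∀ᵐ x ∂μ, x ∈ box a b)
    {f : ℝ → ℝ} (hf : Continuous f) {C : ℝ} (hC : ∀ t, |f t| ≤ C) :
    Tendsto (fun N : ℕ => (N : ℝ)⁻¹ * ∑ k ∈ Finset.range N,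
        ∫ s, f (bounceLength a b s k) ∂μ.prod uniformDirection) atTop
      (𝓝 (∫ v, clockMean (a / |v 0|) (b / |v 1|) f ∂uniformDirection)) := by
  have hC0 : 0 ≤ C := (abs_nonneg _).trans (hC 0)
  have hmeas : ∀ k, AEStronglyMeasurable (fun s => f (bounceLength a b s k))
      (μ.prod uniformDirection) := fun k =>
    (hf.measurable.comp_aemeasurable
      (aemeasurable_bounceLength_prod ha hb hμ k)).aestronglyMeasurable
  have hint : ∀ k, Integrable (fun s => f (bounceLength a b s k)) (μ.prod uniformDirection) :=
    fun k => Integrable.of_bound (hmeas k) C (Eventually.of_forall fun s => hC _)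
  -- The limit along an orbit depends on the direction only, and here μ drops out.
  have hlim : ∫ s, clockMean (a / |s.2 0|) (b / |s.2 1|) f ∂μ.prod uniformDirection
      = ∫ v, clockMean (a / |v 0|) (b / |v 1|) f ∂uniformDirection := by
    rw [integral_fun_snd (fun v : Plane => clockMean (a / |v 0|) (b / |v 1|) f)]
    simp
  rw [← hlim]
  have hdct := tendsto_integral_of_dominated_convergence (μ := μ.prod uniformDirection)
    (F := fun (N : ℕ) s => (N : ℝ)⁻¹ * ∑ k ∈ Finset.range N, f (bounceLength a b s k))
    (f := fun s => clockMean (a / |s.2 0|) (b / |s.2 1|) f) (fun _ => C)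
    (fun N => (integrable_finsetSum _ fun k _ => hint k).const_mul _ |>.aestronglyMeasurable)
    (integrable_const C)
    (fun N => Eventually.of_forall fun s => by
      rcases Nat.eq_zero_or_pos N with rfl | hN
      · simpa using hC0
      have hN' : (0 : ℝ) < N := by exact_mod_cast hN
      rw [norm_mul, norm_inv, Real.norm_natCast, inv_mul_le_iff₀ hN']
      simpa using norm_sum_le_of_le (f := fun k => f (bounceLength a b s k)) (n := fun _ => C)
        (Finset.range N) (fun k _ => hC _))
    (by
      filter_upwards [ae_isIrrational_state ha hb hμ] with s hs
      exact tendsto_bounceLength_average ha hb ⟨hs.1, hs.2.1, hs.2.2.1⟩ hs.2.2.2.1 hs.2.2.2.2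
        hf hC)
  refine hdct.congr fun N => ?_
  rw [integral_const_mul, integral_finsetSum _ fun k _ => hint k]

end particles

section selectionLaw

variable {Ω ι : Type*} [MeasurableSpace Ω] {Q : Measure Ω} [IsProbabilityMeasure Q]
  [Fintype ι] [Nonempty ι] [MeasurableSpace ι] [MeasurableSingletonClass ι]

lemma integral_map_selection {Z : ι → Ω → ℝ} (hZ : ∀ i, AEMeasurable (Z i) Q) {f : ℝ → ℝ}
    (hf : Measurable f) {C : ℝ} (hC : ∀ t, |f t| ≤ C) :
    ∫ t, f t ∂((Q.prod (PMF.uniformOfFintype ι).toMeasure).map fun x => Z x.2 x.1)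
      = (Fintype.card ι : ℝ)⁻¹ * ∑ i, ∫ ω, f (Z i ω) ∂Q := by
  rw [integral_map (aemeasurable_selection hZ) hf.aestronglyMeasurable, integral_selection hZ hf hC]

end selectionLaw

/-- With the particles averaged first, the law of large numbers applies to each bounce index
separately. -/
lemma average_fin_prod (M N : ℕ+) (g : ℕ → ℕ → ℝ) :
    (Fintype.card (Fin M × Fin N) : ℝ)⁻¹ * ∑ j : Fin M × Fin N, g j.1 j.2
      = (N : ℝ)⁻¹ * ∑ k ∈ Finset.range N, ((M : ℝ)⁻¹ * ∑ i ∈ Finset.range M, g i k) := by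
  rw [Fintype.sum_prod_type_right, Finset.sum_range (n := (N : ℕ))]
  simp only [Finset.sum_range (n := (M : ℕ)), ← Finset.mul_sum, Fintype.card_prod,
    Fintype.card_fin, Nat.cast_mul, mul_inv]
  ring

lemma measureReal_Ioo_eq_integral (κ : Measure ℝ) (p q : ℝ) :
    κ.real (Set.Ioo p q) = ∫ t, (Set.Ioo p q).indicator (fun _ => (1 : ℝ)) t ∂κ := by
  rw [integral_indicator_const _ measurableSet_Ioo, smul_eq_mul, mul_one]

lemma abs_indicator_one_le (s : Set ℝ) (t : ℝ) : |s.indicator (fun _ => (1 : ℝ)) t| ≤ 1 := by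
  by_cases h : t ∈ s <;> simp [h]

/-! ### The law of a randomly selected bounce length -/

section selectedLength

variable {a b : ℝ} {μ : Measure Plane}

/-- The law of one of the first `N` bounce lengths of a random particle, chosen uniformly. -/
noncomputable def selectedLengthLaw (a b : ℝ) (μ : Measure Plane) (N : ℕ+) : Measure ℝ :=
  ((μ.prod uniformDirection).prod (PMF.uniformOfFintype (Fin N)).toMeasure).map
    fun x => bounceLength a b x.1 x.2

lemma isProbabilityMeasure_selectedLengthLaw [IsProbabilityMeasure μ] (ha : 0 < a) (hb : 0 < b)
    (hμ : ∀ᵐ x ∂μ, x ∈ box a b) (N : ℕ+) : IsProbabilityMeasure (selectedLengthLaw a b μ N) :=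
  Measure.isProbabilityMeasure_map
    (aemeasurable_selection (Z := fun (k : Fin N) s => bounceLength a b s k)
      fun k => aemeasurable_bounceLength_prod ha hb hμ k)

lemma integral_selectedLengthLaw [IsProbabilityMeasure μ] (ha : 0 < a) (hb : 0 < b) (hμ : ∀ᵐ x ∂μ, x ∈ box a b) (N : ℕ+)
    {f : ℝ → ℝ} (hf : Measurable f) {C : ℝ} (hC : ∀ t, |f t| ≤ C) :
    ∫ t, f t ∂(selectedLengthLaw a b μ N) = (N : ℝ)⁻¹ * ∑ k ∈ Finset.range N,
      ∫ s, f (bounceLength a b s k) ∂μ.prod uniformDirection := by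
  have h := integral_map_selection (Q := μ.prod uniformDirection)
    (Z := fun (k : Fin N) s => bounceLength a b s k)
    (fun k => aemeasurable_bounceLength_prod ha hb hμ k) hf hC
  rw [Fintype.card_fin] at h
  rw [Finset.sum_range]
  exact h

variable {Ω : Type*} [MeasurableSpace Ω] {P : Measure Ω}
  {S : ℕ → Ω → Plane × Plane}

lemma aemeasurable_bounceLength_comp (ha : 0 < a) (hb : 0 < b) (hμ : ∀ᵐ x ∂μ, x ∈ box a b)
    (hS : ∀ i, Measurable (S i)) (hlaw : ∀ i, P.map (S i) = μ.prod uniformDirection) (i k : ℕ) :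
    AEMeasurable (fun ω => bounceLength a b (S i ω) k) P := by
  have := aemeasurable_bounceLength_prod ha hb hμ k
  rw [← hlaw i] at this
  exact this.comp_measurable (hS i)

lemma integral_bounceLength_comp (ha : 0 < a) (hb : 0 < b) (hμ : ∀ᵐ x ∂μ, x ∈ box a b)
    (hS : ∀ i, Measurable (S i)) (hlaw : ∀ i, P.map (S i) = μ.prod uniformDirection) (i k : ℕ)
    {f : ℝ → ℝ} (hf : Measurable f) : ∫ ω, f (bounceLength a b (S i ω) k) ∂P
      = ∫ s, f (bounceLength a b s k) ∂μ.prod uniformDirection := by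
  have := aemeasurable_bounceLength_prod ha hb hμ k
  rw [← hlaw i] at this ⊢
  exact (integral_map (hS i).aemeasurable (hf.comp_aemeasurable this).aestronglyMeasurable).symm

lemma aemeasurable_sampledLength (ha : 0 < a) (hb : 0 < b) (hμ : ∀ᵐ x ∂μ, x ∈ box a b)
    (hS : ∀ i, Measurable (S i)) (hlaw : ∀ i, P.map (S i) = μ.prod uniformDirection) (M N : ℕ+) :
    AEMeasurable (fun x : Ω × (Fin M × Fin N) => bounceLength a b (S x.2.1 x.1) x.2.2)
      (P.prod (uniformSelection M N)) :=
  aemeasurable_selection (Z := fun (j : Fin M × Fin N) ω => bounceLength a b (S j.1 ω) j.2)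
    fun j => aemeasurable_bounceLength_comp ha hb hμ hS hlaw j.1 j.2

/-- A random bounce length of one of `M` random particles has the same law for all `M`. -/
lemma integral_sampledLength [IsProbabilityMeasure μ] [IsProbabilityMeasure P]
    (ha : 0 < a) (hb : 0 < b) (hμ : ∀ᵐ x ∂μ, x ∈ box a b)
    (hS : ∀ i, Measurable (S i)) (hlaw : ∀ i, P.map (S i) = μ.prod uniformDirection) (M N : ℕ+)
    {f : ℝ → ℝ} (hf : Measurable f) {C : ℝ} (hC : ∀ t, |f t| ≤ C) :
    ∫ t, f t ∂((P.prod (uniformSelection M N)).map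
        fun x : Ω × (Fin M × Fin N) => bounceLength a b (S x.2.1 x.1) x.2.2)
      = ∫ t, f t ∂(selectedLengthLaw a b μ N) := by
  rw [uniformSelection, integral_map_selection
    (Z := fun (j : Fin M × Fin N) ω => bounceLength a b (S j.1 ω) j.2)
    (fun j => aemeasurable_bounceLength_comp ha hb hμ hS hlaw j.1 j.2) hf hC,
    average_fin_prod M N fun i k => ∫ ω, f (bounceLength a b (S i ω) k) ∂P,
    integral_selectedLengthLaw ha hb hμ N hf hC]
  simp only [integral_bounceLength_comp ha hb hμ hS hlaw _ _ hf, Finset.sum_const,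
    Finset.card_range, nsmul_eq_mul]
  simp

/-- Almost surely the frequencies of the bounce lengths in rational intervals converge. -/
lemma ae_tendsto_frequency [IsProbabilityMeasure μ] [IsProbabilityMeasure P]
    (ha : 0 < a) (hb : 0 < b) (hμ : ∀ᵐ x ∂μ, x ∈ box a b)
    (hS : ∀ i, Measurable (S i)) (hindep : iIndepFun S P)
    (hlaw : ∀ i, P.map (S i) = μ.prod uniformDirection) :
    ∀ᵐ ω ∂P, ∀ (N : ℕ+) (p q : ℚ), Tendsto (fun M : ℕ+ =>
      ((uniformSelection M N).map
        fun j : Fin M × Fin N => bounceLength a b (S j.1 ω) j.2).real (Set.Ioo (p : ℝ) q)) atTop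
      (𝓝 ((selectedLengthLaw a b μ N).real (Set.Ioo (p : ℝ) q))) := by
  -- Countably many indices and rational intervals leave a single null set that serves every N.
  have hslln : ∀ᵐ ω ∂P, ∀ (k : ℕ) (p q : ℚ), Tendsto (fun n : ℕ => (n : ℝ)⁻¹ *
      ∑ i ∈ Finset.range n, (Set.Ioo (p : ℝ) q).indicator (fun _ => (1 : ℝ))
        (bounceLength a b (S i ω) k)) atTop
      (𝓝 (∫ s, (Set.Ioo (p : ℝ) q).indicator (fun _ => (1 : ℝ)) (bounceLength a b s k)
        ∂μ.prod uniformDirection)) := by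
    rw [ae_all_iff]; intro k
    rw [ae_all_iff]; intro p
    rw [ae_all_iff]; intro q
    exact strong_law_of_bounded hS hindep hlaw
      (h := fun s => (Set.Ioo (p : ℝ) q).indicator (fun _ => (1 : ℝ)) (bounceLength a b s k))
      ((measurable_const.indicator measurableSet_Ioo).comp_aemeasurable
        (aemeasurable_bounceLength_prod ha hb hμ k))
      fun s => abs_indicator_one_le _ _
  filter_upwards [hslln] with ω hω N p q
  have hgm : Measurable ((Set.Ioo (p : ℝ) q).indicator (fun _ => (1 : ℝ))) :=
    measurable_const.indicator measurableSet_Ioo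
  rw [measureReal_Ioo_eq_integral, integral_selectedLengthLaw ha hb hμ N hgm
    (abs_indicator_one_le _)]
  have hlim := (tendsto_finsetSum (Finset.range N) fun k _ => hω k p q).const_mul (N : ℝ)⁻¹
  refine (hlim.comp tendsto_PNat_val_atTop_atTop).congr fun M => ?_
  rw [measureReal_Ioo_eq_integral,
    integral_map (measurable_of_finite _).aemeasurable hgm.aestronglyMeasurable, uniformSelection,
    integral_uniformOfFintype, average_fin_prod M N fun i k =>
      (Set.Ioo (p : ℝ) q).indicator (fun _ => (1 : ℝ)) (bounceLength a b (S i ω) k)]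
  rfl

end selectedLength

theorem theorem4 {a b : ℝ} (ha : 0 < a) (hab : a ≤ b)
    (μ : Measure Plane) [IsProbabilityMeasure μ] (hμ : ∀ᵐ x ∂μ, x ∈ box a b)
    {Ω : Type*} [MeasurableSpace Ω] (P : Measure Ω) [IsProbabilityMeasure P]
    -- initial states (position, direction) of the particles: i.i.d., the position has law `μ`,
    -- the direction is uniform on the circle and independent of the position
    (S : ℕ → Ω → Plane × Plane) (hS : ∀ i, Measurable (S i)) (hindep : iIndepFun S P)
    (hlaw : ∀ i, P.map (S i) = μ.prod uniformDirection) :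
    -- the limit distribution has density `absorptionPDF a b`
    ∃ Y : ProbabilityMeasure ℝ,
      (Y : Measure ℝ) = volume.withDensity (fun t => ENNReal.ofReal (absorptionPDF a b t)) ∧
      (∀ t, 0 ≤ absorptionPDF a b t) ∧
      (∀ t, 0 < t → t < √(a ^ 2 + b ^ 2) → t ≠ a → t ≠ b →
        absorptionPDF a b t = singularPart a b t + smoothPart a b t) ∧
      ∃ YN : ℕ+ → ProbabilityMeasure ℝ,
        -- convergence as `M → ∞` of the random variable `Y_{M,N}` obtained by first sampling
        -- the particles and then selecting one of their bounce lengths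
        (∀ N : ℕ+, TendstoInDistribution
          (fun (M : ℕ+) (x : Ω × (Fin M × Fin N)) => bounceLength a b (S x.2.1 x.1) x.2.2)
          atTop (fun y : ℝ => y)
          (fun M => P.prod (uniformSelection M N)) (YN N : Measure ℝ)) ∧
        -- convergence as `M → ∞` of the random selection of a bounce length for fixed particles,
        -- for almost every sample of the particles
        (∀ᵐ ω ∂P, ∀ N : ℕ+, TendstoInDistribution
          (fun (M : ℕ+) (j : Fin M × Fin N) => bounceLength a b (S j.1 ω) j.2)
          atTop (fun y : ℝ => y)
          (fun M => uniformSelection M N) (YN N : Measure ℝ)) ∧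
        -- convergence as `N → ∞`
        Tendsto YN atTop (𝓝 Y) := by
  have hb : 0 < b := ha.trans_le hab
  obtain ⟨YN, hYN⟩ : ∃ YN : ℕ+ → ProbabilityMeasure ℝ,
      ∀ N, (YN N : Measure ℝ) = selectedLengthLaw a b μ N :=
    ⟨fun N => ⟨_, isProbabilityMeasure_selectedLengthLaw ha hb hμ N⟩, fun _ => rfl⟩
  refine ⟨⟨_, isProbabilityMeasure_withDensity_absorptionPDF ha hab⟩, rfl,
    absorptionPDF_nonneg ha hab,
    fun t h0 hr h1 h2 => absorptionPDF_eq_add ha hab h0 hr h1 h2,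
    YN, fun N => ⟨fun M => aemeasurable_sampledLength ha hb hμ hS hlaw M N, aemeasurable_id, ?_⟩,
    ?_, ?_⟩
  · refine ProbabilityMeasure.tendsto_iff_forall_integral_tendsto.2 fun f => ?_
    -- The particles are identically distributed, so the integrals are constant in M.
    refine tendsto_const_nhds.congr fun M => ?_
    simp only [ProbabilityMeasure.coe_mk, Measure.map_id', hYN]
    exact (integral_sampledLength ha hb hμ hS hlaw M N f.continuous.measurable
      fun t => f.norm_coe_le_norm t).symm
  · filter_upwards [ae_tendsto_frequency ha hb hμ hS hindep hlaw] with ω hω N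
    refine ⟨fun M => (measurable_of_finite _).aemeasurable, aemeasurable_id,
      tendsto_probabilityMeasure_of_rat fun p q => ?_⟩
    simp only [ProbabilityMeasure.coe_mk, Measure.map_id', hYN]
    exact hω N p q
  · refine ProbabilityMeasure.tendsto_iff_forall_integral_tendsto.2 fun f => ?_
    have hfC : ∀ t, |f t| ≤ ‖f‖ := fun t => f.norm_coe_le_norm t
    have h := (tendsto_integral_bounceLength ha hb hμ f.continuous hfC).comp
      tendsto_PNat_val_atTop_atTop
    rw [← integral_withDensity_absorptionPDF ha hab f.continuous hfC] at h
    refine h.congr fun N => ?_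
    rw [hYN, integral_selectedLengthLaw ha hb hμ N f.continuous.measurable hfC]
    rfl
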